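/- For each $n$ let $X_n\in\mathbb R^{n\times p_n}$ be a fixed design matrix, $\beta_n^*\in\mathbb R^{p_n}$ a fixed true coefficient vector with support $\xi_n^*=\{j:\beta^*_{j,n}\neq 0\}$ and $s_n=|\xi_n^*|\ge 1$ for all large $n$, and let $\Phi_n\in\mathbb R^{m_n\times n}$ be a random sketching matrix with independent $N(0,1/n)$ entries. The data are $y_n=X_n\beta_n^*+\varepsilon_n$ with $\varepsilon_n\sim N(0,I_n)$ independent of $\Phi_n$; only $\tilde y_n=\Phi_ny_n$ and $\tilde X_n=\Phi_nX_n$ are used. The working model is $\tilde y_n\mid\beta\sim N(\tilde X_n\beta,I_{m_n})$, with density $f(\tilde y_n\mid\beta)$, and the prior on $\beta\in\mathbb R^{p_n}$ has the product density $\pi_n(\beta)=\prod_{j}h_n(\beta_j)$, where $h_n$ is a probability density on $\mathbb R$ (which may involve hyperparameters depending on $n$). The posterior mass of a set $C$ is $$\Pi_n(C)=\frac{\int_C f(\tilde y_n\mid\beta)\pi_n(\beta)\,d\beta}{\int f(\tilde y_n\mid\beta)\pi_n(\beta)\,d\beta},$$ and $E_{\beta_n^*}$ denotes expectation over $\varepsilon_n$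 for given $\Phi_n$. Put $a_n=\sqrt{s_n\log(p_n)/m_n}\,/\,p_n$. Let $m_n\to\infty$, $p_n\to\infty$ and $\log m_n=O(\log p_n)$ (which holds in particular if $m_n=o(p_n)$). Assume that, for constants $C',\eta,u>0$ and a nondecreasing sequence $(M_n)$, (A) for all large $n$, $|x_{ij}|\le 1$ for all entries of $X_n$; (B) $\|\Phi_n\Phi_n'-I_{m_n}\|_2\le C'\sqrt{m_n/n}$ with probability tending to $1$; (C) $s_n\log p_n=o(m_n)$ and $m_n=o(n)$; (D) there are integers $\bar s_n$ with $s_n=o(\bar s_n)$ such that, for all large $n$, the smallest eigenvalue of $X_{n,\xi}'X_{n,\xi}/n$ is at least $\eta$ for all $\xi\supseteq\xi_n^*$ with $|\xi|\le\bar s_n$, where $X_{n,\xi}$ consists of the columns of $X_n$ indexed by $\xi$; (E) $\max_{j\in\xi_n^*}|\beta^*_{j,n}|<M_n/2$ for all large $n$; (F) $1-\int_{-a_n}^{a_n}h_n(x)\,dx\le p_n^{-(1+u)}$ for all large $n$; (G) $\inf_{|x|\le M_n}h_n(x)>0$ for all large $n$, and $-\log\bigl(\inf_{|x|\le M_n}h_n(x)\bigr)=O(\log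 p_n)$. Then there are a constant $E>0$ and integers $\tilde s_n=O(s_n)$ such that, with $\theta_n=E\sqrt{s_n\log(p_n)/m_n}$ and $$\mathcal C_n=\{\beta:\|\beta-\beta_n^*\|_2>3\theta_n\}\cup\{\beta:|\beta_k|\ge a_n\text{ for at least }\tilde s_n\text{ indices }k\},$$ the expected posterior mass $E_{\beta_n^*}(\Pi_n(\mathcal C_n))$ tends to $0$ in probability with respect to $\Phi_n$ as $n\to\infty$ (equivalently, since it lies in $[0,1]$, its mean over $\Phi_n$ tends to $0$). -/

import Mathlib

open Filter Topology MeasureTheory ProbabilityTheory Asymptotics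

namespace SketchedRegression

noncomputable section

/-- The set of indices of the nonzero entries of `β`. -/
def activeSet {p : ℕ} (β : Fin p → ℝ) : Finset (Fin p) :=
  letI := Classical.decPred fun j => β j ≠ 0
  Finset.univ.filter fun j => β j ≠ 0

/-- The number of nonzero entries of `β`. -/
def sparsity {p : ℕ} (β : Fin p → ℝ) : ℕ := (activeSet β).card

/-- The spectral norm of a square real matrix. -/
def matrixNorm₂ {m : ℕ} (A : Matrix (Fin m) (Fin m) ℝ) : ℝ :=
  ‖Matrix.toEuclideanCLM (𝕜 := ℝ) A‖

/-- The smallest (real) eigenvalue of a symmetric matrix of positive size. -/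
def minEigenvalue {ι : Type*} [Fintype ι] [DecidableEq ι] (A : Matrix ι ι ℝ) : ℝ :=
  sInf (spectrum ℝ A)

/-- The sub-matrix of `X` formed by the columns with index in `ξ`. -/
def columns {n p : ℕ} (X : Matrix (Fin n) (Fin p) ℝ) (ξ : Finset (Fin p)) :
    Matrix (Fin n) ξ ℝ :=
  X.submatrix id fun j : ξ => (j : Fin p)

/-- The entries of the random `m × n` matrix `Φ` are independent with law `N(0, 1/n)`. -/
def IsGaussianSketch {Ω : Type*} [MeasurableSpace Ω] {m n : ℕ}
    (Φ : Ω → Matrix (Fin m) (Fin n) ℝ) (P : Measure Ω) : Prop :=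
  iIndepFun (fun (k : Fin m × Fin n) (ω : Ω) => Φ ω k.1 k.2) P ∧
    ∀ i j, HasLaw (fun ω => Φ ω i j) (gaussianReal 0 ((n : NNReal)⁻¹)) P

/-- `h` is a probability density on the real line. -/
structure IsProbDensity (h : ℝ → ℝ) : Prop where
  measurable : Measurable h
  nonneg : ∀ x, 0 ≤ h x
  integral_eq_one : ∫ x, h x = 1

/-- The density at `y` of the normal law with mean `Xt β` and identity covariance: the likelihood
of the working model `y = Xt β + ε`, `ε ~ N(0, I)`. -/
def likelihood {m p : ℕ} (Xt : Matrix (Fin m) (Fin p) ℝ) (y : Fin m → ℝ) (β : Fin p → ℝ) : ℝ :=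
  ∏ i, gaussianPDFReal (Xt.mulVec β i) 1 (y i)

/-- The product prior density with common marginal density `h`. -/
def priorDensity {p : ℕ} (h : ℝ → ℝ) (β : Fin p → ℝ) : ℝ := ∏ j, h (β j)

/-- The posterior mass of the set `C` given the data `y` and the design `Xt`. -/
def posterior {m p : ℕ} (Xt : Matrix (Fin m) (Fin p) ℝ) (h : ℝ → ℝ) (y : Fin m → ℝ)
    (C : Set (Fin p → ℝ)) : ℝ :=
  (∫ β in C, likelihood Xt y β * priorDensity h β) /
    ∫ β, likelihood Xt y β * priorDensity h β

/-- For a given sketching matrix `Φ`, the expectation of the posterior mass of `C` (computed from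
the sketched data `Φ y` and `Φ X`) when `y = X βs + ε` with `ε ~ N(0, I)`. -/
def expectedPosterior {m n p : ℕ} (Φ : Matrix (Fin m) (Fin n) ℝ) (X : Matrix (Fin n) (Fin p) ℝ)
    (βs : Fin p → ℝ) (h : ℝ → ℝ) (C : Set (Fin p → ℝ)) : ℝ :=
  ∫ ε : Fin n → ℝ, posterior (Φ * X) h (Φ.mulVec (X.mulVec βs + ε)) C
    ∂(Measure.pi fun _ => gaussianReal 0 1)

/-- `√(s log p / m)`. -/
def baseRate (s p m : ℕ) : ℝ := √((s : ℝ) * Real.log p / m)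

/-- The threshold `√(s log p / m) / p`. -/
def threshold (s p m : ℕ) : ℝ := baseRate s p m / p

/-- The coefficient vectors at Euclidean distance more than `3 θ` from `βs`. -/
def farSet {p : ℕ} (βs : Fin p → ℝ) (θ : ℝ) : Set (Fin p → ℝ) :=
  {β | 3 * θ < ‖WithLp.toLp 2 (β - βs)‖}

/-- The coefficient vectors with at least `k` entries of absolute value at least `a`. -/
def manyLargeSet (p : ℕ) (k : ℕ) (a : ℝ) : Set (Fin p → ℝ) :=
  {β | k ≤ Set.ncard {j | a ≤ |β j|}}

end

end SketchedRegression

open SketchedRegression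

open SketchedRegression

namespace SketchedRegression
open scoped Matrix

/-! ### Gaussian product measures -/

/-! Write `w = Φ ε` and `b = s log p`. The posterior mass of a set is a ratio of prior integrals of
the likelihood ratio `exp (logRatio Xt w (β - βs))`, where `logRatio` is a noise term linear in `d =
β - βs` minus half of `‖Xt d‖²`.

Three properties hold for most `Φ`: the covariance `Φ Φᵀ` of `w` is within `τ = o(1)` of the
identity, the sketched columns have length at most `2√m`, and `Xt = Φ X` inherits a restricted
eigenvalue bound (`restricted_eigenvalue_of_grid`, through a finite grid of sparse vectors). For
most `ε`, moreover, `w` has a controlled inner product with all sparse combinations of the columns,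
simultaneously over all supports (`NoiseBounded`).

On these events the denominator is at least `exp (-(12 + K) b)`: the box of radius `threshold`
around `βs` has prior mass at least `exp (-K b)`, and the likelihood ratio there is at least `exp
(-12 b)`. The numerator has three pieces. Far from `βs` with few large entries, the restricted
eigenvalue makes the ratio at most `exp (-(13 + K) b)`. With many large entries and a signal large
compared to their number, the ratio is at most 1 and the prior mass is tiny. With many large entries
and a weak signal, only the mean of the ratio over `ε` is bounded: misspecified noise can inflate it
to `exp (τ ‖Xt d‖² / 2)`, which the prior absorbs through an exponential moment of the number of
large entries. `enorm_expectedPosterior_le` combines these bounds for a fixed good `Φ`. -/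

lemma measurable_mulVec {ι κ : Type*} [Fintype κ] (A : Matrix ι κ ℝ) :
    Measurable (fun x : κ → ℝ => A *ᵥ x) := by
  refine measurable_pi_lambda _ fun i => ?_
  change Measurable fun x : κ → ℝ => ∑ j, A i j * x j
  fun_prop

/-- The image of a Gaussian product measure under a matrix with orthogonal rows of equal length. -/
lemma map_mulVec_pi_gaussianReal {ι κ : Type*} [Fintype ι] [Fintype κ] [DecidableEq ι]
    (A : Matrix ι κ ℝ) {v w : NNReal} (hA : (v : ℝ) • (A * Aᵀ) = (w : ℝ) • (1 : Matrix ι ι ℝ)) :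
    (Measure.pi fun _ : κ => gaussianReal 0 v).map (fun x => A *ᵥ x) =
      Measure.pi fun _ : ι => gaussianReal 0 w := by
  have hmeas := measurable_mulVec A
  have : IsProbabilityMeasure
      ((Measure.pi fun _ : κ => gaussianReal 0 v).map (fun x => A *ᵥ x)) :=
    Measure.isProbabilityMeasure_map hmeas.aemeasurable
  -- Characteristic functions identify the law: at `t` the left side is `exp (-v ‖Aᵀ t‖² / 2)`, and
  -- `hA` turns `v ‖Aᵀ t‖²` into `w ‖t‖²`.
  rw [← charFun_eq_pi_iff]
  intro t
  have h1 : charFun (((Measure.pi fun _ : κ => gaussianReal 0 v).map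
      (fun x => A *ᵥ x)).map (WithLp.toLp 2)) t =
      charFun ((Measure.pi fun _ : κ => gaussianReal 0 v).map (WithLp.toLp 2))
        (WithLp.toLp 2 (Aᵀ *ᵥ t.ofLp)) := by
    rw [Measure.map_map (by fun_prop) hmeas, charFun_apply, charFun_apply, integral_map,
      integral_map]
    · refine integral_congr_ae (ae_of_all _ fun x => ?_)
      simp only [Function.comp, EuclideanSpace.inner_eq_star_dotProduct, star_trivial]
      rw [Matrix.mulVec_transpose, Matrix.dotProduct_mulVec]
    · exact (by fun_prop : Measurable _).aemeasurable
    · exact (by fun_prop : Measurable _).aestronglyMeasurable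
    · exact ((by fun_prop : Measurable (WithLp.toLp 2)).comp hmeas).aemeasurable
    · exact (by fun_prop : Measurable _).aestronglyMeasurable
  rw [h1, charFun_pi]
  simp_rw [charFun_gaussianReal, ← Complex.exp_sum]
  congr 1
  have h2 : (v : ℝ) * ((Aᵀ *ᵥ t.ofLp) ⬝ᵥ (Aᵀ *ᵥ t.ofLp)) = w * (t.ofLp ⬝ᵥ t.ofLp) := by
    have := congrArg (fun B : Matrix ι ι ℝ => t.ofLp ⬝ᵥ (B *ᵥ t.ofLp)) hA
    simp only [Matrix.smul_mulVec, dotProduct_smul, smul_eq_mul, Matrix.one_mulVec] at this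
    rw [← this, ← Matrix.mulVec_mulVec, Matrix.mulVec_transpose,
      Matrix.dotProduct_mulVec t.ofLp A]
  have h3 : ∑ k, (v : ℝ) * (Aᵀ *ᵥ t.ofLp) k ^ 2 / 2 = ∑ i, (w : ℝ) * t i ^ 2 / 2 := by
    simp_rw [← Finset.sum_div, ← Finset.mul_sum]
    simp only [dotProduct, ← sq] at h2
    rw [h2]
  have h4 := congrArg (fun x : ℝ => -(x : ℂ)) h3
  push_cast at h4
  simpa [Finset.sum_neg_distrib] using h4

lemma lintegral_pi_prod {ι : Type*} [Fintype ι] {E : ι → Type*} [∀ i, MeasurableSpace (E i)]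
    (μ : ∀ i, Measure (E i)) [∀ i, IsProbabilityMeasure (μ i)] (f : ∀ i, E i → ENNReal)
    (hf : ∀ i, Measurable (f i)) :
    ∫⁻ x, ∏ i, f i (x i) ∂(Measure.pi μ) = ∏ i, ∫⁻ x, f i x ∂(μ i) := by
  rw [lintegral_prod_eq_prod_lintegral_of_indepFun Finset.univ
    (fun i (x : ∀ i, E i) => f i (x i))
    (iIndepFun_pi fun i => (hf i).aemeasurable) (fun i => (hf i).comp (measurable_pi_apply i))]
  refine Finset.prod_congr rfl fun i _ => ?_
  exact (measurePreserving_eval μ i).lintegral_comp (hf i)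

lemma lintegral_exp_mul_sq_gaussianReal {c : ℝ} (hc : c < 1 / 2) :
    ∫⁻ z, ENNReal.ofReal (Real.exp (c * z ^ 2)) ∂(gaussianReal 0 1) =
      ENNReal.ofReal (√(1 - 2 * c))⁻¹ := by
  rw [gaussianReal_of_var_ne_zero _ one_ne_zero,
    lintegral_withDensity_eq_lintegral_mul _ (measurable_gaussianPDF 0 1) (by fun_prop)]
  have h1 : ∀ z : ℝ, (gaussianPDF 0 1 * fun z => ENNReal.ofReal (Real.exp (c * z ^ 2))) z =
      ENNReal.ofReal ((√(2 * Real.pi))⁻¹ * Real.exp (-(1 / 2 - c) * z ^ 2)) := by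
    intro z
    simp only [Pi.mul_apply, gaussianPDF_def, gaussianPDFReal_def]
    rw [← ENNReal.ofReal_mul (by positivity), mul_assoc, ← Real.exp_add]
    congr 3 <;> simp <;> ring_nf
  simp_rw [h1]
  rw [← ofReal_integral_eq_lintegral_ofReal
    ((integrable_exp_neg_mul_sq (by linarith)).const_mul _) (ae_of_all _ fun z => by positivity),
    integral_const_mul, integral_gaussian]
  congr 1
  rw [← Real.sqrt_inv, ← Real.sqrt_inv, ← Real.sqrt_mul (by positivity)]
  congr 1
  have : (1 / 2 - c) ≠ 0 := by linarith
  have : (1 - 2 * c) ≠ 0 := by linarith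
  field_simp

lemma lintegral_exp_mul_sum_sq {ι : Type*} [Fintype ι] {c : ℝ} (hc : c < 1 / 2) :
    ∫⁻ z : ι → ℝ, ENNReal.ofReal (Real.exp (c * ∑ i, z i ^ 2))
      ∂(Measure.pi fun _ => gaussianReal 0 1) =
      ENNReal.ofReal ((√(1 - 2 * c))⁻¹ ^ Fintype.card ι) := by
  simp_rw [Finset.mul_sum, Real.exp_sum,
    ENNReal.ofReal_prod_of_nonneg (fun _ _ => (Real.exp_pos _).le)]
  rw [lintegral_pi_prod _ (fun _ z => ENNReal.ofReal (Real.exp (c * z ^ 2)))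
    (fun _ => by fun_prop)]
  simp_rw [lintegral_exp_mul_sq_gaussianReal hc]
  rw [Finset.prod_const, ENNReal.ofReal_pow (by positivity), Finset.card_univ]

/-- Chernoff bound with exponent `1/4`, at which each squared coordinate has moment generating
function `√2`. -/
lemma pi_gaussianReal_sum_sq_ge {ι : Type*} [Fintype ι] (t : ℝ) :
    (Measure.pi fun _ : ι => gaussianReal 0 1) {z | t ≤ ∑ i, z i ^ 2} ≤
      ENNReal.ofReal (√2 ^ Fintype.card ι * Real.exp (-(t / 4))) := by
  have h := mul_meas_ge_le_lintegral (μ := Measure.pi fun _ : ι => gaussianReal 0 1)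
    (f := fun z => ENNReal.ofReal (Real.exp (1 / 4 * ∑ i, z i ^ 2))) (by fun_prop)
    (ENNReal.ofReal (Real.exp (t / 4)))
  rw [lintegral_exp_mul_sum_sq (by norm_num)] at h
  have hset : {z : ι → ℝ | t ≤ ∑ i, z i ^ 2} ⊆ {z | ENNReal.ofReal (Real.exp (t / 4)) ≤
      ENNReal.ofReal (Real.exp (1 / 4 * ∑ i, z i ^ 2))} := by
    intro z hz
    simp only [Set.mem_ofPred_eq] at hz ⊢
    exact ENNReal.ofReal_le_ofReal (Real.exp_le_exp.2 (by linarith))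
  refine (measure_mono hset).trans ?_
  rw [Real.exp_neg, ← div_eq_mul_inv, ENNReal.ofReal_div_of_pos (Real.exp_pos _)]
  rw [ENNReal.le_div_iff_mul_le (by left; simp [Real.exp_pos]) (by left; simp), mul_comm]
  convert h using 3
  rw [← Real.sqrt_inv]
  norm_num

/-- Chernoff bound with exponent `-1`: each coordinate contributes `1/√3 ≤ e^(-1/2)`, and the
threshold gives back `e^(1/4)` per coordinate. -/
lemma pi_gaussianReal_sum_sq_le {ι : Type*} [Fintype ι] :
    (Measure.pi fun _ : ι => gaussianReal 0 1) {z | ∑ i, z i ^ 2 ≤ Fintype.card ι / 4} ≤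
      ENNReal.ofReal (Real.exp (-(Fintype.card ι / 4))) := by
  set d := Fintype.card ι
  have h := mul_meas_ge_le_lintegral (μ := Measure.pi fun _ : ι => gaussianReal 0 1)
    (f := fun z => ENNReal.ofReal (Real.exp ((-1) * ∑ i, z i ^ 2))) (by fun_prop)
    (ENNReal.ofReal (Real.exp (-((d : ℝ) / 4))))
  rw [lintegral_exp_mul_sum_sq (by norm_num)] at h
  have hset : {z : ι → ℝ | ∑ i, z i ^ 2 ≤ d / 4} ⊆
      {z | ENNReal.ofReal (Real.exp (-((d : ℝ) / 4))) ≤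
      ENNReal.ofReal (Real.exp ((-1) * ∑ i, z i ^ 2))} := by
    intro z hz
    simp only [Set.mem_ofPred_eq] at hz ⊢
    exact ENNReal.ofReal_le_ofReal (Real.exp_le_exp.2 (by linarith))
  refine (measure_mono hset).trans ?_
  rw [mul_comm, ← ENNReal.le_div_iff_mul_le (by left; simp [Real.exp_pos]) (by left; simp),
    ← ENNReal.ofReal_div_of_pos (Real.exp_pos _)] at h
  refine h.trans (ENNReal.ofReal_le_ofReal ?_)
  rw [div_le_iff₀ (Real.exp_pos _), ← Real.exp_add]
  have h3 : (√(1 - 2 * (-1 : ℝ)))⁻¹ ≤ Real.exp (-(1 / 2)) := by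
    rw [Real.exp_neg]
    refine inv_anti₀ (Real.exp_pos _) ?_
    refine Real.le_sqrt_of_sq_le ?_
    rw [← Real.exp_nat_mul]
    norm_num
    linarith [Real.exp_one_lt_d9]
  calc _ ≤ (Real.exp (-(1 / 2))) ^ d := pow_le_pow_left₀ (by positivity) h3 _
    _ = _ := by rw [← Real.exp_nat_mul]; congr 1; ring

lemma lintegral_exp_dotProduct {n : ℕ} (a : Fin n → ℝ) :
    ∫⁻ z, ENNReal.ofReal (Real.exp (a ⬝ᵥ z)) ∂(Measure.pi fun _ : Fin n => gaussianReal 0 1) =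
      ENNReal.ofReal (Real.exp ((a ⬝ᵥ a) / 2)) := by
  simp_rw [dotProduct, Real.exp_sum,
    ENNReal.ofReal_prod_of_nonneg (fun _ _ => (Real.exp_pos _).le)]
  rw [lintegral_pi_prod _ (fun i z => ENNReal.ofReal (Real.exp (a i * z)))
    (fun _ => by fun_prop), Finset.sum_div, Real.exp_sum,
    ENNReal.ofReal_prod_of_nonneg (fun _ _ => (Real.exp_pos _).le)]
  refine Finset.prod_congr rfl fun i _ => ?_
  rw [← ofReal_integral_eq_lintegral_ofReal (integrable_exp_mul_gaussianReal _)
    (ae_of_all _ fun z => (Real.exp_pos _).le)]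
  have := congrFun (mgf_id_gaussianReal (μ := 0) (v := 1)) (a i)
  simp only [mgf, id] at this
  rw [this]
  congr 2
  simp [sq]

/-- A standard Gaussian vector has a large inner product with no unit vector of a subspace of small
dimension. -/
lemma pi_gaussianReal_exists_inner_sq_gt {n k : ℕ} (V : Submodule ℝ (EuclideanSpace ℝ (Fin n)))
    (hV : Module.finrank ℝ V ≤ k) (t : ℝ) :
    (Measure.pi fun _ : Fin n => gaussianReal 0 1)
        {ε | ∃ u ∈ V, t * ‖u‖ ^ 2 < (ε ⬝ᵥ u.ofLp) ^ 2} ≤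
      ENNReal.ofReal (√2 ^ k * Real.exp (-(t / 4))) := by
  set d := Module.finrank ℝ V
  let e := stdOrthonormalBasis ℝ V
  -- The rows of `A` are an orthonormal basis of `V`, so `A ε` is standard Gaussian in dimension
  -- `d`, and by Cauchy–Schwarz `(ε ⬝ᵥ u)² ≤ ‖A ε‖² ‖u‖²` for every `u ∈ V` at once.
  let A : Matrix (Fin d) (Fin n) ℝ := fun i j => (e i : EuclideanSpace ℝ (Fin n)).ofLp j
  have hA : ((1 : NNReal) : ℝ) • (A * Aᵀ) = ((1 : NNReal) : ℝ) • (1 : Matrix (Fin d) (Fin d) ℝ) := by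
    congr 1
    ext i j
    have := orthonormal_iff_ite.1 e.orthonormal j i
    rw [Submodule.coe_inner, EuclideanSpace.inner_eq_star_dotProduct, star_trivial] at this
    rw [Matrix.mul_apply, Matrix.one_apply]
    simp only [eq_comm (a := i)]
    exact this
  have hmeas := measurable_mulVec A
  have hsub : {ε : Fin n → ℝ | ∃ u ∈ V, t * ‖u‖ ^ 2 < (ε ⬝ᵥ u.ofLp) ^ 2} ⊆
      (fun x => A *ᵥ x) ⁻¹' {z | t ≤ ∑ i, z i ^ 2} := by
    rintro ε ⟨u, hu, hlt⟩
    simp only [Set.mem_preimage, Set.mem_ofPred_eq]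
    by_contra! hcon
    have hexp : (ε ⬝ᵥ u.ofLp) = ∑ i, (A *ᵥ ε) i * inner ℝ (e i) (⟨u, hu⟩ : V) := by
      have h1 := congrArg (fun v : V => (v : EuclideanSpace ℝ (Fin n)).ofLp)
        (e.sum_repr' (⟨u, hu⟩ : V))
      conv_lhs => rw [← h1]
      simp only [Submodule.coe_sum, Submodule.coe_smul, WithLp.ofLp_sum, WithLp.ofLp_smul,
        dotProduct_sum, dotProduct_smul, smul_eq_mul, Matrix.mulVec]
      refine Finset.sum_congr rfl fun i _ => ?_
      rw [mul_comm, dotProduct_comm]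
    have hcs := Finset.sum_mul_sq_le_sq_mul_sq Finset.univ (fun i => (A *ᵥ ε) i)
      (fun i => inner ℝ (e i) (⟨u, hu⟩ : V))
    rw [← hexp, e.sum_sq_inner_right] at hcs
    have hn : ‖(⟨u, hu⟩ : V)‖ = ‖u‖ := rfl
    rw [hn] at hcs
    have := mul_le_mul_of_nonneg_right hcon.le (sq_nonneg ‖u‖)
    linarith
  refine (measure_mono hsub).trans ?_
  rw [← Measure.map_apply hmeas (measurableSet_le (by fun_prop) (by fun_prop)),
    map_mulVec_pi_gaussianReal A hA]
  refine (pi_gaussianReal_sum_sq_ge t).trans (ENNReal.ofReal_le_ofReal ?_)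
  rw [Fintype.card_fin]
  gcongr
  exact Real.one_le_sqrt.2 one_le_two

/-! ### The Euclidean norm on coordinate vectors -/

/-- The Euclidean norm of a coordinate vector. -/
noncomputable def l2norm {ι : Type*} [Fintype ι] (v : ι → ℝ) : ℝ := ‖WithLp.toLp 2 v‖

section l2norm
variable {ι κ : Type*} [Fintype ι] [Fintype κ]

lemma l2norm_nonneg (v : ι → ℝ) : 0 ≤ l2norm v := norm_nonneg _

lemma l2norm_sq (v : ι → ℝ) : l2norm v ^ 2 = v ⬝ᵥ v := by
  rw [l2norm, EuclideanSpace.real_norm_sq_eq]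
  simp [dotProduct, sq]

lemma zero_le_dotProduct_self (v : ι → ℝ) : 0 ≤ v ⬝ᵥ v := l2norm_sq v ▸ sq_nonneg _

lemma l2norm_add_le (v w : ι → ℝ) : l2norm (v + w) ≤ l2norm v + l2norm w := by
  simpa [l2norm] using norm_add_le (WithLp.toLp 2 v) (WithLp.toLp 2 w)

lemma l2norm_smul (c : ℝ) (v : ι → ℝ) : l2norm (c • v) = |c| * l2norm v := by
  simp [l2norm, norm_smul]

lemma l2norm_sum_le {κ : Type*} (s : Finset κ) (f : κ → ι → ℝ) :
    l2norm (∑ k ∈ s, f k) ≤ ∑ k ∈ s, l2norm (f k) := by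
  simpa [l2norm] using norm_sum_le s (fun k => WithLp.toLp 2 (f k))

lemma l2norm_le_sum_abs (v : ι → ℝ) : l2norm v ≤ ∑ i, |v i| := by
  refine abs_le_of_sq_le_sq' ?_ (Finset.sum_nonneg fun _ _ => abs_nonneg _) |>.2
  rw [l2norm_sq]
  calc v ⬝ᵥ v = ∑ i, |v i| * |v i| := by simp [dotProduct]
    _ ≤ ∑ i, |v i| * ∑ j, |v j| := Finset.sum_le_sum fun i _ => by
        gcongr
        exact Finset.single_le_sum (f := fun j => |v j|) (fun _ _ => abs_nonneg _)
          (Finset.mem_univ i)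
    _ = _ := by rw [← Finset.sum_mul, sq]

lemma abs_dotProduct_le (v w : ι → ℝ) : |v ⬝ᵥ w| ≤ l2norm v * l2norm w := by
  have := abs_real_inner_le_norm (WithLp.toLp 2 w) (WithLp.toLp 2 v)
  rw [EuclideanSpace.inner_eq_star_dotProduct, star_trivial] at this
  rw [mul_comm]
  exact this

lemma mulVec_eq_sum_smul {ι : Type*} (A : Matrix ι κ ℝ) (v : κ → ℝ) : A *ᵥ v = ∑ j, v j • A.col j := by
  rw [Matrix.mulVec_eq_sum]
  simp only [op_smul_eq_smul]
  rfl

lemma l2norm_mulVec_le (A : Matrix ι κ ℝ) {B : ℝ} (hB : ∀ j, l2norm (A.col j) ≤ B) (v : κ → ℝ) :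
    l2norm (A *ᵥ v) ≤ (∑ j, |v j|) * B := by
  rw [mulVec_eq_sum_smul, Finset.sum_mul]
  refine (l2norm_sum_le _ _).trans (Finset.sum_le_sum fun j _ => ?_)
  rw [l2norm_smul]
  exact mul_le_mul_of_nonneg_left (hB j) (abs_nonneg _)

lemma abs_dotProduct_mulVec_le (A : Matrix ι κ ℝ) (w : ι → ℝ) {B : ℝ}
    (hB : ∀ j, |w ⬝ᵥ A.col j| ≤ B) (v : κ → ℝ) :
    |w ⬝ᵥ (A *ᵥ v)| ≤ (∑ j, |v j|) * B := by
  rw [mulVec_eq_sum_smul, dotProduct_sum, Finset.sum_mul]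
  refine (Finset.abs_sum_le_sum_abs _ _).trans (Finset.sum_le_sum fun j _ => ?_)
  rw [dotProduct_smul, smul_eq_mul, abs_mul]
  exact mul_le_mul_of_nonneg_left (hB j) (abs_nonneg _)

end l2norm

/-! ### Concentration of the sketch -/

section sketch
variable {Ω : Type*} [MeasurableSpace Ω] {P : Measure Ω} {m n p : ℕ}
  {Φ : Ω → Matrix (Fin m) (Fin n) ℝ}

lemma IsGaussianSketch.aemeasurable (hΦ : IsGaussianSketch Φ P) (i j) :
    AEMeasurable (fun ω => Φ ω i j) P := (hΦ.2 i j).aemeasurable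

lemma IsGaussianSketch.hasLaw_mulVec (hΦ : IsGaussianSketch Φ P) (hn : 0 < n) {x : Fin n → ℝ}
    (hx : x ⬝ᵥ x = n) :
    HasLaw (fun ω => Φ ω *ᵥ x) (Measure.pi fun _ => gaussianReal 0 1) P := by
  have h1 : HasLaw (fun ω (k : Fin m × Fin n) => Φ ω k.1 k.2)
      (Measure.pi fun _ => gaussianReal 0 ((n : NNReal)⁻¹)) P :=
    hΦ.1.hasLaw_pi fun k => hΦ.2 k.1 k.2
  -- `Φ x` is `A` applied to the vectorized `Φ`. The rows of `A` have disjoint supports and squared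
  -- length `n`, which cancels the variance `1/n`.
  let A : Matrix (Fin m) (Fin m × Fin n) ℝ :=
    Matrix.of fun i k => if i = k.1 then x k.2 else 0
  have hA : (((n : NNReal)⁻¹ : NNReal) : ℝ) • (A * Aᵀ) =
      ((1 : NNReal) : ℝ) • (1 : Matrix (Fin m) (Fin m) ℝ) := by
    ext i j
    simp only [Matrix.smul_apply, Matrix.mul_apply, A, Matrix.transpose_apply, Matrix.of_apply,
      Matrix.one_apply,
      Fintype.sum_prod_type]
    have hn' : (n : ℝ) ≠ 0 := by positivity
    have hx' : ∑ k, x k * x k = n := hx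
    by_cases hij : i = j
    · subst hij
      simp [hx', hn']
    · simp [hij]
  have h2 : HasLaw (fun y : Fin m × Fin n → ℝ => A *ᵥ y) (Measure.pi fun _ => gaussianReal 0 1)
      (Measure.pi fun _ => gaussianReal 0 ((n : NNReal)⁻¹)) :=
    ⟨(measurable_mulVec A).aemeasurable, map_mulVec_pi_gaussianReal A hA⟩
  convert h2.comp h1 using 1
  ext ω i
  simp [A, Matrix.mulVec, dotProduct, Fintype.sum_prod_type, mul_comm]

lemma IsGaussianSketch.exists_scaled (hn : 0 < n) {x : Fin n → ℝ} (hx : 0 < x ⬝ᵥ x) :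
    ∃ c : ℝ, c ^ 2 = n / (x ⬝ᵥ x) ∧ (c • x) ⬝ᵥ (c • x) = n := by
  refine ⟨√(n / (x ⬝ᵥ x)), Real.sq_sqrt (by positivity), ?_⟩
  rw [dotProduct_smul, smul_dotProduct, smul_eq_mul, smul_eq_mul, ← mul_assoc,
    Real.mul_self_sqrt (by positivity)]
  field_simp

/-- Stretching `x` to squared length `n` makes `Φ x` standard Gaussian and can only enlarge the
event. -/
lemma IsGaussianSketch.measure_mulVec_gt (hΦ : IsGaussianSketch Φ P) (hn : 0 < n) {x : Fin n → ℝ}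
    (hx : x ⬝ᵥ x ≤ n) :
    P {ω | 4 * m < (Φ ω *ᵥ x) ⬝ᵥ (Φ ω *ᵥ x)} ≤ ENNReal.ofReal (Real.exp (-(m / 4 : ℝ))) := by
  rcases (zero_le_dotProduct_self x).eq_or_lt with h0 | h0
  · have hx0 : x = 0 := dotProduct_self_eq_zero.1 h0.symm
    subst hx0
    have : {ω | (4 * m : ℝ) < (Φ ω *ᵥ 0) ⬝ᵥ (Φ ω *ᵥ 0)} = ∅ := by
      ext ω
      simp
    rw [this]
    simp
  obtain ⟨c, hc, hcx⟩ := IsGaussianSketch.exists_scaled hn h0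
  have hlaw := hΦ.hasLaw_mulVec hn hcx
  have hc1 : 1 ≤ c ^ 2 := by rw [hc, le_div_iff₀ h0]; linarith
  have hsub : {ω | (4 * m : ℝ) < (Φ ω *ᵥ x) ⬝ᵥ (Φ ω *ᵥ x)} ⊆
      {ω | (fun z : Fin m → ℝ => 4 * (m : ℝ) ≤ ∑ i, z i ^ 2) (Φ ω *ᵥ (c • x))} := by
    intro ω hω
    simp only [Set.mem_ofPred_eq] at hω ⊢
    have : ∑ i, (Φ ω *ᵥ (c • x)) i ^ 2 = c ^ 2 * ((Φ ω *ᵥ x) ⬝ᵥ (Φ ω *ᵥ x)) := by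
      rw [Matrix.mulVec_smul, dotProduct, Finset.mul_sum]
      refine Finset.sum_congr rfl fun i _ => ?_
      simp only [Pi.smul_apply, smul_eq_mul]; ring
    rw [this]
    nlinarith [zero_le_dotProduct_self (Φ ω *ᵥ x)]
  refine (measure_mono hsub).trans ?_
  rw [hlaw.measure_eq (p := fun z : Fin m → ℝ => 4 * (m : ℝ) ≤ ∑ i, z i ^ 2)
    (measurableSet_le (by fun_prop) (by fun_prop))]
  refine (pi_gaussianReal_sum_sq_ge _).trans (ENNReal.ofReal_le_ofReal ?_)
  rw [Fintype.card_fin]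
  -- This leaves `e^(3/4) · e^(-1) = e^(-1/4)` per coordinate.
  have h2 : √2 ≤ Real.exp (3 / 4) := by
    refine Real.sqrt_le_iff.2 ⟨(Real.exp_pos _).le, ?_⟩
    have := Real.add_one_le_exp (3 / 4 : ℝ)
    nlinarith
  calc √2 ^ m * Real.exp (-(4 * m / 4)) ≤ Real.exp (3 / 4) ^ m * Real.exp (-(4 * m / 4)) := by
        gcongr
    _ = _ := by rw [← Real.exp_nat_mul, ← Real.exp_add]; congr 1; ring

lemma IsGaussianSketch.measure_mulVec_lt (hΦ : IsGaussianSketch Φ P) (hn : 0 < n) (x : Fin n → ℝ) :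
    P {ω | (Φ ω *ᵥ x) ⬝ᵥ (Φ ω *ᵥ x) < m / 4 * ((x ⬝ᵥ x) / n)} ≤
      ENNReal.ofReal (Real.exp (-(m / 4 : ℝ))) := by
  rcases (zero_le_dotProduct_self x).eq_or_lt with h0 | h0
  · have hx0 : x = 0 := dotProduct_self_eq_zero.1 h0.symm
    subst hx0
    have : {ω | (Φ ω *ᵥ 0) ⬝ᵥ (Φ ω *ᵥ 0) < m / 4 * (((0 : Fin n → ℝ) ⬝ᵥ 0) / n)} = ∅ := by
      ext ω
      simp
    rw [this]
    simp
  obtain ⟨c, hc, hcx⟩ := IsGaussianSketch.exists_scaled hn h0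
  have hlaw := hΦ.hasLaw_mulVec hn hcx
  have hsub : {ω | (Φ ω *ᵥ x) ⬝ᵥ (Φ ω *ᵥ x) < m / 4 * ((x ⬝ᵥ x) / n)} ⊆
      {ω | (fun z : Fin m → ℝ => ∑ i, z i ^ 2 ≤ Fintype.card (Fin m) / 4)
        (Φ ω *ᵥ (c • x))} := by
    intro ω hω
    simp only [Set.mem_ofPred_eq] at hω ⊢
    have : ∑ i, (Φ ω *ᵥ (c • x)) i ^ 2 = c ^ 2 * ((Φ ω *ᵥ x) ⬝ᵥ (Φ ω *ᵥ x)) := by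
      rw [Matrix.mulVec_smul, dotProduct, Finset.mul_sum]
      refine Finset.sum_congr rfl fun i _ => ?_
      simp only [Pi.smul_apply, smul_eq_mul]; ring
    rw [this, Fintype.card_fin]
    have hcpos : 0 < c ^ 2 := by rw [hc]; positivity
    have h3 : c ^ 2 * (m / 4 * ((x ⬝ᵥ x) / n)) = m / 4 := by
      rw [hc]
      field_simp
    rw [← h3]
    exact (mul_lt_mul_of_pos_left hω hcpos).le
  refine (measure_mono hsub).trans ?_
  rw [hlaw.measure_eq (p := fun z : Fin m → ℝ => ∑ i, z i ^ 2 ≤ Fintype.card (Fin m) / 4)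
    (measurableSet_le (by fun_prop) (by fun_prop))]
  refine pi_gaussianReal_sum_sq_le.trans ?_
  rw [Fintype.card_fin]

lemma IsGaussianSketch.measure_exists_col_gt (hΦ : IsGaussianSketch Φ P) (hn : 0 < n)
    {X : Matrix (Fin n) (Fin p) ℝ} (hX : ∀ i j, |X i j| ≤ 1) :
    P {ω | ∃ j, 4 * m < l2norm ((Φ ω * X).col j) ^ 2} ≤
      ENNReal.ofReal (p * Real.exp (-(m / 4 : ℝ))) := by
  have hcol : ∀ ω j, (Φ ω * X).col j = Φ ω *ᵥ X.col j := fun ω j => by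
    ext i; simp [Matrix.mul_apply, Matrix.mulVec, dotProduct]
  have hset : {ω | ∃ j, 4 * m < l2norm ((Φ ω * X).col j) ^ 2} =
      ⋃ j : Fin p, {ω | 4 * m < (Φ ω *ᵥ X.col j) ⬝ᵥ (Φ ω *ᵥ X.col j)} := by
    ext ω
    simp [l2norm_sq, hcol]
  rw [hset]
  refine (measure_iUnion_fintype_le _ _).trans ?_
  refine (Finset.sum_le_sum fun j _ => hΦ.measure_mulVec_gt hn ?_).trans ?_
  · calc X.col j ⬝ᵥ X.col j ≤ ∑ _i : Fin n, (1 : ℝ) := Finset.sum_le_sum fun i _ => by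
          have := hX i j
          rw [abs_le] at this
          simp only [Matrix.col_apply]
          nlinarith
      _ = n := by simp
  · rw [Finset.sum_const, Finset.card_univ, Fintype.card_fin, nsmul_eq_mul,
      ENNReal.ofReal_mul (by positivity), ENNReal.ofReal_natCast]

/-- A union bound, hence for finite sets only; applied to `sparseGrid`, from which all sparse
vectors are reached by approximation. -/
lemma IsGaussianSketch.measure_exists_mem_lt (hΦ : IsGaussianSketch Φ P) (hn : 0 < n)
    (X : Matrix (Fin n) (Fin p) ℝ) (T : Finset (Fin p → ℝ)) :
    P {ω | ∃ x ∈ T, l2norm ((Φ ω * X) *ᵥ x) ^ 2 < m / 4 * (l2norm (X *ᵥ x) ^ 2 / n)} ≤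
      ENNReal.ofReal (T.card * Real.exp (-(m / 4 : ℝ))) := by
  have hset : {ω | ∃ x ∈ T, l2norm ((Φ ω * X) *ᵥ x) ^ 2 < m / 4 * (l2norm (X *ᵥ x) ^ 2 / n)} =
      ⋃ x ∈ T, {ω | (Φ ω *ᵥ (X *ᵥ x)) ⬝ᵥ (Φ ω *ᵥ (X *ᵥ x)) <
        m / 4 * (((X *ᵥ x) ⬝ᵥ (X *ᵥ x)) / n)} := by
    ext ω
    simp [l2norm_sq]
  rw [hset]
  refine (measure_biUnion_finset_le _ _).trans ?_
  refine (Finset.sum_le_sum fun x _ => hΦ.measure_mulVec_lt hn _).trans ?_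
  rw [Finset.sum_const, nsmul_eq_mul,
      ENNReal.ofReal_mul (by positivity), ENNReal.ofReal_natCast]

end sketch

/-! ### A grid of sparse vectors -/

open Classical in
/-- The sums of at most `q` vectors `(c / N) e_j` with integers `|c| ≤ N`. -/
noncomputable def sparseGrid (p N : ℕ) : ℕ → Finset (Fin p → ℝ)
  | 0 => {0}
  | q + 1 => (sparseGrid p N q ×ˢ ((Finset.univ : Finset (Fin p)) ×ˢ
      Finset.Icc (-(N : ℤ)) N)).image fun y => y.1 + Pi.single y.2.1 ((y.2.2 : ℝ) / N)

lemma card_sparseGrid_le (p N q : ℕ) : (sparseGrid p N q).card ≤ (p * (2 * N + 1)) ^ q := by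
  induction q with
  | zero => simp [sparseGrid]
  | succ q ih =>
    rw [sparseGrid, pow_succ]
    refine Finset.card_image_le.trans ?_
    rw [Finset.card_product, Finset.card_product, Finset.card_univ, Fintype.card_fin, Int.card_Icc]
    have : ((N : ℤ) + 1 - -(N : ℤ)).toNat = 2 * N + 1 := by omega
    rw [this]
    gcongr

lemma mem_sparseGrid {p N : ℕ} (hp : 0 < p) (c : Fin p → ℤ) (q : ℕ) :
    ∀ S : Finset (Fin p), S.card ≤ q → (∀ j ∈ S, |c j| ≤ N) →
      (fun j => if j ∈ S then (c j : ℝ) / N else 0) ∈ sparseGrid p N q := by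
  induction q with
  | zero =>
    intro S hS _
    have : S = ∅ := by simpa using hS
    subst this
    simp only [sparseGrid, Finset.mem_singleton]
    ext j; simp
  | succ q ih =>
    intro S hS hc
    simp only [sparseGrid, Finset.mem_image, Finset.mem_product, Finset.mem_univ, true_and,
      Finset.mem_Icc, Prod.exists]
    rcases S.eq_empty_or_nonempty with rfl | ⟨k, hk⟩
    -- No index is left to remove, so a zero multiple of an arbitrary basis vector fills the slot;
    -- this is why `p` must be positive.
    · refine ⟨_, ⟨0, hp⟩, 0, ⟨ih ∅ (by simp) (by simp), by simp⟩, ?_⟩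
      ext j; simp
    · refine ⟨_, k, c k, ⟨ih (S.erase k) ?_ fun j hj => hc j (Finset.mem_of_mem_erase hj), ?_⟩, ?_⟩
      · rw [Finset.card_erase_of_mem hk]; omega
      · exact abs_le.1 (hc k hk)
      · ext j
        by_cases hjk : j = k
        · subst hjk; simp [hk]
        · simp [hjk]

/-- The restricted eigenvalue condition for a sketched design follows from that of the design and
from a lower bound on a grid of sparse vectors. -/
lemma restricted_eigenvalue_of_grid {m n p q N : ℕ} {η : ℝ} (hη : 0 < η) (hp : 0 < p) (hn : 0 < n)
    {X : Matrix (Fin n) (Fin p) ℝ} {Xt : Matrix (Fin m) (Fin p) ℝ} (hN : 0 < N)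
    (hN₁ : 2 * (q : ℝ) ≤ N) (hN₂ : 16 * (q : ℝ) ≤ √η * N)
    (hcol : ∀ j, l2norm (Xt.col j) ≤ 2 * √m)
    (hgrid : ∀ x ∈ sparseGrid p N q,
      m / 4 * (l2norm (X *ᵥ x) ^ 2 / n) ≤ l2norm (Xt *ᵥ x) ^ 2)
    {S : Finset (Fin p)} (hS : S.card ≤ q)
    (heig : ∀ x : Fin p → ℝ, (∀ j ∉ S, x j = 0) → η * n * l2norm x ^ 2 ≤ l2norm (X *ᵥ x) ^ 2)
    {x : Fin p → ℝ} (hx : ∀ j ∉ S, x j = 0) :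
    √(m * η) / 8 * l2norm x ≤ l2norm (Xt *ᵥ x) := by
  -- it suffices to treat unit vectors
  suffices hunit : ∀ x : Fin p → ℝ, (∀ j ∉ S, x j = 0) → l2norm x = 1 →
      √(m * η) / 8 ≤ l2norm (Xt *ᵥ x) by
    rcases (l2norm_nonneg x).eq_or_lt with h0 | h0
    · rw [← h0]; simpa using l2norm_nonneg _
    · have := hunit ((l2norm x)⁻¹ • x) (fun j hj => by simp [hx j hj])
        (by rw [l2norm_smul, abs_of_pos (by positivity), inv_mul_cancel₀ h0.ne'])
      rw [Matrix.mulVec_smul, l2norm_smul, abs_of_pos (by positivity), inv_mul_eq_div,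
        le_div_iff₀ h0] at this
      exact this
  intro x hx hx1
  have hN' : (0 : ℝ) < N := by exact_mod_cast hN
  have habs : ∀ j, |x j| ≤ 1 := by
    intro j
    have h1 : x j ^ 2 ≤ 1 := by
      rw [← one_pow 2, ← hx1, l2norm_sq, dotProduct, sq]
      exact Finset.single_le_sum (f := fun j => x j * x j) (fun i _ => mul_self_nonneg _)
        (Finset.mem_univ j)
    exact abs_le_one_iff_mul_self_le_one.2 (by rw [← sq]; exact h1)
  -- Rounding towards zero keeps `|c j| ≤ N`, so that the rounded vector stays in the grid.
  let c : Fin p → ℤ := fun j => if 0 ≤ x j then ⌊x j * N⌋ else ⌈x j * N⌉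
  have hc₁ : ∀ j, |x j - c j / N| ≤ 1 / N := by
    intro j
    have : |x j * N - c j| ≤ 1 := by
      simp only [c]
      split_ifs
      · rw [abs_le]; constructor <;> linarith [Int.floor_le (x j * N), Int.lt_floor_add_one (x j * N)]
      · rw [abs_le]; constructor <;> linarith [Int.le_ceil (x j * N), Int.ceil_lt_add_one (x j * N)]
    rw [show x j - c j / N = (x j * N - c j) / N by field_simp, abs_div, abs_of_pos hN']
    gcongr
  have hc₂ : ∀ j, |c j| ≤ N := by
    intro j
    have h1 := abs_le.1 (habs j)
    simp only [c]
    rw [abs_le]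
    split_ifs with h0
    · have h2 : 0 ≤ ⌊x j * N⌋ := Int.floor_nonneg.2 (by positivity)
      have h3 : (⌊x j * N⌋ : ℝ) ≤ (N : ℤ) := (Int.floor_le _).trans (by push_cast; nlinarith)
      constructor
      · omega
      · exact_mod_cast h3
    · have h2 : ⌈x j * N⌉ ≤ 0 := Int.ceil_le.2 (by push_cast; nlinarith)
      have h3 : ((-(N : ℤ) : ℤ) : ℝ) ≤ ⌈x j * N⌉ :=
        le_trans (by push_cast; nlinarith) (Int.le_ceil _)
      constructor
      · exact_mod_cast h3
      · omega
  set y : Fin p → ℝ := fun j => if j ∈ S then (c j : ℝ) / N else 0 with hy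
  have hyT : y ∈ sparseGrid p N q := mem_sparseGrid hp c q S hS fun j _ => hc₂ j
  have hyS : ∀ j ∉ S, y j = 0 := fun j hj => by simp [hy, hj]
  have hsum : ∑ j, |(x - y) j| ≤ q / N := by
    calc ∑ j, |(x - y) j| ≤ ∑ j, if j ∈ S then (1 : ℝ) / N else 0 := by
          refine Finset.sum_le_sum fun j _ => ?_
          by_cases hj : j ∈ S
          · simpa [hy, hj] using hc₁ j
          · simp [hy, hj, hx j hj]
      _ = S.card * (1 / N) := by simp
      _ ≤ q * (1 / N) := by gcongr
      _ = _ := by ring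
  -- The rounding error is small on two scales: `hN₁` keeps `‖y‖ ≥ 1/2`, so that `‖Xt y‖ ≥ √(m η) /
  -- 4`, and `hN₂` makes `‖Xt (y - x)‖` at most half of that.
  have hqN : (q : ℝ) / N ≤ 1 / 2 := by rw [div_le_iff₀ hN']; linarith
  have hqN₂ : (q : ℝ) / N ≤ √η / 16 := by rw [div_le_iff₀ hN']; linarith
  have hyn : 1 / 2 ≤ l2norm y := by
    have h1 := l2norm_add_le y (x - y)
    rw [add_sub_cancel, hx1] at h1
    linarith [l2norm_le_sum_abs (x - y)]
  have h2 : (√(m * η) / 4) ^ 2 ≤ l2norm (Xt *ᵥ y) ^ 2 := by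
    refine le_trans ?_ (hgrid y hyT)
    have h3 := heig y hyS
    have h4 : η * (1 / 4) ≤ l2norm (X *ᵥ y) ^ 2 / n := by
      rw [le_div_iff₀ (by positivity)]
      refine le_trans ?_ h3
      have : (1 / 4 : ℝ) ≤ l2norm y ^ 2 := by nlinarith
      have hn' : (0 : ℝ) < η * n := by positivity
      nlinarith
    calc (√(m * η) / 4) ^ 2 = m / 4 * (η * (1 / 4)) := by
          rw [div_pow, Real.sq_sqrt (by positivity)]; ring
      _ ≤ _ := by gcongr
  have h5 := abs_le_of_sq_le_sq' h2 (l2norm_nonneg _) |>.2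
  have h6 : l2norm (Xt *ᵥ (y - x)) ≤ √η / 16 * (2 * √m) := by
    refine (l2norm_mulVec_le Xt hcol _).trans ?_
    have : ∑ j, |(y - x) j| = ∑ j, |(x - y) j| :=
      Finset.sum_congr rfl fun j _ => by simp [abs_sub_comm]
    rw [this]
    gcongr
    linarith
  have h7 := l2norm_add_le (Xt *ᵥ x) (Xt *ᵥ (y - x))
  rw [← Matrix.mulVec_add, add_sub_cancel] at h7
  have h8 : √(m * η) = √m * √η := Real.sqrt_mul (by positivity) _
  rw [h8] at h5 ⊢
  linarith

/-! ### Spectral bounds -/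

/-- `Φ ε` has covariance `Φ Φᵀ`, while the working model assumes the identity; this measures the
discrepancy. -/
lemma l2norm_transpose_mulVec_sq_le {m n : ℕ} {Φ : Matrix (Fin m) (Fin n) ℝ} {τ : ℝ}
    (h : matrixNorm₂ (Φ * Φᵀ - 1) ≤ τ) (v : Fin m → ℝ) :
    l2norm (Φᵀ *ᵥ v) ^ 2 ≤ (1 + τ) * l2norm v ^ 2 := by
  have h1 : l2norm (Φᵀ *ᵥ v) ^ 2 = v ⬝ᵥ ((Φ * Φᵀ - 1) *ᵥ v) + l2norm v ^ 2 := by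
    rw [l2norm_sq, l2norm_sq, Matrix.sub_mulVec, Matrix.one_mulVec, dotProduct_sub,
      sub_add_cancel, ← Matrix.mulVec_mulVec, Matrix.mulVec_transpose,
      Matrix.dotProduct_mulVec v Φ]
  have h2 : l2norm ((Φ * Φᵀ - 1) *ᵥ v) ≤ τ * l2norm v := by
    have := (Matrix.toEuclideanCLM (𝕜 := ℝ) (Φ * Φᵀ - 1)).le_opNorm (WithLp.toLp 2 v)
    rw [Matrix.toEuclideanCLM_toLp] at this
    exact this.trans (mul_le_mul_of_nonneg_right h (norm_nonneg _))
  have h3 := (le_abs_self _).trans (abs_dotProduct_le v ((Φ * Φᵀ - 1) *ᵥ v))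
  have h4 := mul_le_mul_of_nonneg_left h2 (l2norm_nonneg v)
  rw [h1]
  nlinarith

/-- Subtracting `η` times the identity shifts the spectrum by `η`, leaving a positive semidefinite
matrix. -/
lemma dotProduct_mulVec_ge_of_le_minEigenvalue {ι : Type*} [Fintype ι] [DecidableEq ι]
    {A : Matrix ι ι ℝ} (hA : A.IsHermitian) {η : ℝ} (h : η ≤ minEigenvalue A) (x : ι → ℝ) :
    η * (x ⬝ᵥ x) ≤ x ⬝ᵥ (A *ᵥ x) := by
  have hspec : ∀ μ ∈ spectrum ℝ A, η ≤ μ := by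
    intro μ hμ
    refine h.trans (csInf_le ?_ hμ)
    rw [hA.spectrum_real_eq_range_eigenvalues]
    exact (Set.finite_range _).bddBelow
  have hB : (A - algebraMap ℝ (Matrix ι ι ℝ) η).IsHermitian := by
    refine hA.sub ?_
    rw [Algebra.algebraMap_eq_smul_one]
    exact Matrix.isHermitian_one.smul (IsSelfAdjoint.all η)
  have hpos : (A - algebraMap ℝ (Matrix ι ι ℝ) η).PosSemidef := by
    rw [hB.posSemidef_iff_eigenvalues_nonneg]
    intro i
    have h1 : hB.eigenvalues i ∈ spectrum ℝ (A - algebraMap ℝ (Matrix ι ι ℝ) η) := by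
      rw [hB.spectrum_real_eq_range_eigenvalues]; exact ⟨i, rfl⟩
    rw [← spectrum.sub_singleton_eq] at h1
    obtain ⟨μ, hμ, c, hc, hμc⟩ := h1
    have := hspec μ hμ
    rw [Set.mem_singleton_iff] at hc
    simp only [Pi.zero_apply, ← hμc, hc]
    linarith
  have h2 := hpos.dotProduct_mulVec_nonneg x
  rw [star_trivial, Matrix.sub_mulVec, dotProduct_sub, Algebra.algebraMap_eq_smul_one,
    Matrix.smul_mulVec, Matrix.one_mulVec, dotProduct_smul, smul_eq_mul] at h2
  linarith

lemma l2norm_mulVec_sq_ge_of_le_minEigenvalue {n p : ℕ} (hn : 0 < n)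
    (X : Matrix (Fin n) (Fin p) ℝ) {S : Finset (Fin p)} {η : ℝ}
    (h : η ≤ minEigenvalue ((n : ℝ)⁻¹ • ((columns X S)ᵀ * columns X S))) {x : Fin p → ℝ}
    (hx : ∀ j ∉ S, x j = 0) : η * n * l2norm x ^ 2 ≤ l2norm (X *ᵥ x) ^ 2 := by
  have hA : ((n : ℝ)⁻¹ • ((columns X S)ᵀ * columns X S)).IsHermitian := by
    refine Matrix.IsHermitian.smul ?_ (IsSelfAdjoint.all _)
    have := Matrix.isHermitian_conjTranspose_mul_self (columns X S)
    rwa [Matrix.conjTranspose_eq_transpose_of_trivial] at this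
  have h1 := dotProduct_mulVec_ge_of_le_minEigenvalue hA h (fun j : S => x j)
  have h2 : (columns X S) *ᵥ (fun j : S => x j) = X *ᵥ x := by
    ext i
    simp only [Matrix.mulVec, dotProduct, columns, Matrix.submatrix_apply, id]
    rw [Finset.sum_coe_sort S (fun j => X i j * x j)]
    exact Finset.sum_subset (Finset.subset_univ _) fun j _ hj => by simp [hx j hj]
  have h3 : (fun j : S => x j) ⬝ᵥ (fun j : S => x j) = l2norm x ^ 2 := by
    rw [l2norm_sq]
    simp only [dotProduct]
    rw [Finset.sum_coe_sort S (fun j => x j * x j)]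
    exact Finset.sum_subset (Finset.subset_univ _) fun j _ hj => by simp [hx j hj]
  rw [Matrix.smul_mulVec, dotProduct_smul, ← Matrix.mulVec_mulVec, Matrix.dotProduct_mulVec,
    Matrix.vecMul_transpose, h2, h3, ← l2norm_sq, smul_eq_mul] at h1
  have hn' : (0 : ℝ) < n := by exact_mod_cast hn
  rw [inv_mul_eq_div, le_div_iff₀ hn'] at h1
  linarith

/-! ### The posterior as a ratio of integrals against the prior -/

/-- The log-likelihood ratio between `β` and `βs`, where `w` is the noise and `d = β - βs`. -/
noncomputable def logRatio {m p : ℕ} (Xt : Matrix (Fin m) (Fin p) ℝ) (w : Fin m → ℝ)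
    (d : Fin p → ℝ) : ℝ :=
  w ⬝ᵥ (Xt *ᵥ d) - l2norm (Xt *ᵥ d) ^ 2 / 2

/-- The factor at `βs` does not depend on `β`, so it cancels in the posterior. -/
lemma likelihood_add_eq {m p : ℕ} (Xt : Matrix (Fin m) (Fin p) ℝ) (w : Fin m → ℝ)
    (βs β : Fin p → ℝ) :
    likelihood Xt (Xt *ᵥ βs + w) β =
      likelihood Xt (Xt *ᵥ βs + w) βs * Real.exp (logRatio Xt w (β - βs)) := by
  simp only [likelihood, logRatio, l2norm_sq, dotProduct, Matrix.mulVec_sub, Finset.sum_div]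
  rw [← Finset.sum_sub_distrib, Real.exp_sum, ← Finset.prod_mul_distrib]
  refine Finset.prod_congr rfl fun i _ => ?_
  rw [gaussianPDFReal_def, gaussianPDFReal_def]
  beta_reduce
  rw [mul_assoc (√ _)⁻¹, ← Real.exp_add]
  congr 2
  simp only [Pi.add_apply, Pi.sub_apply, NNReal.coe_one]
  ring

lemma likelihood_pos {m p : ℕ} (Xt : Matrix (Fin m) (Fin p) ℝ) (y : Fin m → ℝ) (β : Fin p → ℝ) :
    0 < likelihood Xt y β :=
  Finset.prod_pos fun _ _ => gaussianPDFReal_pos _ _ _ one_ne_zero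

@[fun_prop]
lemma continuous_l2norm {ι : Type*} [Fintype ι] : Continuous (l2norm : (ι → ℝ) → ℝ) := by
  unfold l2norm
  exact continuous_norm.comp (PiLp.continuous_toLp 2 _)

lemma continuous_logRatio {m p : ℕ} (Xt : Matrix (Fin m) (Fin p) ℝ) :
    Continuous fun z : (Fin m → ℝ) × (Fin p → ℝ) => logRatio Xt z.1 z.2 := by
  unfold logRatio
  have h : Continuous fun z : (Fin m → ℝ) × (Fin p → ℝ) => Xt *ᵥ z.2 :=
    Continuous.matrix_mulVec continuous_const continuous_snd
  exact (continuous_fst.dotProduct h).sub (((continuous_l2norm.comp h).pow 2).div_const 2)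

/-- The one-dimensional prior as a measure. -/
noncomputable def marginalPrior (h : ℝ → ℝ) : Measure ℝ :=
  volume.withDensity fun x => ENNReal.ofReal (h x)

/-- The product prior as a measure. -/
noncomputable def productPrior (p : ℕ) (h : ℝ → ℝ) : Measure (Fin p → ℝ) :=
  Measure.pi fun _ => marginalPrior h

namespace IsProbDensity
variable {h : ℝ → ℝ}

lemma integrable (hh : IsProbDensity h) : Integrable h := by
  by_contra hcon
  have := hh.integral_eq_one
  rw [integral_undef hcon] at this
  exact zero_ne_one this

lemma isProbabilityMeasure_marginalPrior (hh : IsProbDensity h) :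
    IsProbabilityMeasure (marginalPrior h) := by
  constructor
  rw [marginalPrior, withDensity_apply _ MeasurableSet.univ, Measure.restrict_univ,
    ← ofReal_integral_eq_lintegral_ofReal hh.integrable (ae_of_all _ hh.nonneg),
    hh.integral_eq_one, ENNReal.ofReal_one]

lemma isProbabilityMeasure_productPrior (hh : IsProbDensity h) (p : ℕ) :
    IsProbabilityMeasure (productPrior p h) := by
  have := hh.isProbabilityMeasure_marginalPrior
  unfold productPrior
  infer_instance

lemma marginalPrior_apply (hh : IsProbDensity h) {s : Set ℝ} (hs : MeasurableSet s) :
    marginalPrior h s = ENNReal.ofReal (∫ x in s, h x) := by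
  rw [marginalPrior, withDensity_apply _ hs, ofReal_integral_eq_lintegral_ofReal
    hh.integrable.integrableOn (ae_of_all _ hh.nonneg)]

lemma measurable_priorDensity (hh : IsProbDensity h) (p : ℕ) :
    Measurable (priorDensity h : (Fin p → ℝ) → ℝ) :=
  Finset.measurable_fun_prod _ fun j _ => hh.measurable.comp (measurable_pi_apply j)

lemma priorDensity_nonneg (hh : IsProbDensity h) {p : ℕ} (β : Fin p → ℝ) :
    0 ≤ priorDensity h β := Finset.prod_nonneg fun _ _ => hh.nonneg _

lemma productPrior_eq_withDensity (hh : IsProbDensity h) (p : ℕ) :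
    productPrior p h = volume.withDensity fun β => ENNReal.ofReal (priorDensity h β) := by
  have := hh.isProbabilityMeasure_marginalPrior
  refine Measure.pi_eq fun s hs => ?_
  rw [withDensity_apply _ (MeasurableSet.univ_pi hs),
    ← lintegral_indicator (MeasurableSet.univ_pi hs)]
  have h1 : ∀ β : Fin p → ℝ, (Set.univ.pi s).indicator
      (fun β => ENNReal.ofReal (priorDensity h β)) β =
      ENNReal.ofReal (∏ j, (s j).indicator h (β j)) := by
    intro β
    by_cases hβ : β ∈ Set.univ.pi s
    · rw [Set.indicator_of_mem hβ, priorDensity]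
      congr 1
      refine Finset.prod_congr rfl fun j _ => ?_
      rw [Set.indicator_of_mem (hβ j trivial)]
    · rw [Set.indicator_of_notMem hβ]
      simp only [Set.mem_pi, Set.mem_univ, true_imp_iff, not_forall] at hβ
      obtain ⟨j, hj⟩ := hβ
      rw [Finset.prod_eq_zero (Finset.mem_univ j) (Set.indicator_of_notMem hj _),
        ENNReal.ofReal_zero]
  simp_rw [h1]
  rw [volume_pi, ← ofReal_integral_eq_lintegral_ofReal
    (Integrable.fintype_prod fun j => hh.integrable.indicator (hs j))
    (ae_of_all _ fun β => Finset.prod_nonneg fun j _ => Set.indicator_nonneg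
      (fun x _ => hh.nonneg x) _),
    integral_fintype_prod_eq_prod, ENNReal.ofReal_prod_of_nonneg
      fun j _ => integral_nonneg fun x => Set.indicator_nonneg (fun x _ => hh.nonneg x) _]
  refine Finset.prod_congr rfl fun j _ => ?_
  rw [integral_indicator (hs j), hh.marginalPrior_apply (hs j)]

end IsProbDensity

lemma setIntegral_likelihood_mul_priorDensity {m p : ℕ} (Xt : Matrix (Fin m) (Fin p) ℝ)
    {h : ℝ → ℝ} (hh : IsProbDensity h) (w : Fin m → ℝ) (βs : Fin p → ℝ) {C : Set (Fin p → ℝ)}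
    (hC : MeasurableSet C) :
    ∫ β in C, likelihood Xt (Xt *ᵥ βs + w) β * priorDensity h β =
      likelihood Xt (Xt *ᵥ βs + w) βs *
        (∫⁻ β in C, ENNReal.ofReal (Real.exp (logRatio Xt w (β - βs)))
          ∂(productPrior p h)).toReal := by
  have hmeas : Measurable fun β : Fin p → ℝ => Real.exp (logRatio Xt w (β - βs)) :=
    Real.measurable_exp.comp (((continuous_logRatio Xt).comp
      (by fun_prop : Continuous fun β : Fin p → ℝ => (w, β - βs))).measurable)
  have h0 : ∀ β, likelihood Xt (Xt *ᵥ βs + w) β * priorDensity h β =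
      likelihood Xt (Xt *ᵥ βs + w) βs *
        (Real.exp (logRatio Xt w (β - βs)) * priorDensity h β) := fun β => by
    rw [likelihood_add_eq Xt w βs β, mul_assoc]
  rw [integral_congr_ae (ae_of_all _ h0), integral_const_mul, integral_eq_lintegral_of_nonneg_ae
    (ae_of_all _ fun β => mul_nonneg (Real.exp_pos _).le (hh.priorDensity_nonneg β))
    (hmeas.mul (hh.measurable_priorDensity p)).aestronglyMeasurable,
    hh.productPrior_eq_withDensity, setLIntegral_withDensity_eq_setLIntegral_mul _
      (hh.measurable_priorDensity p).ennreal_ofReal hmeas.ennreal_ofReal hC]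
  congr 2
  refine lintegral_congr fun β => ?_
  rw [mul_comm, ENNReal.ofReal_mul (hh.priorDensity_nonneg β)]
  rfl

/-- An inequality suffices, and since `toReal` sends `∞` to `0` it needs no finiteness of the
quotient. -/
lemma enorm_posterior_le {m p : ℕ} (Xt : Matrix (Fin m) (Fin p) ℝ) {h : ℝ → ℝ}
    (hh : IsProbDensity h) (w : Fin m → ℝ) (βs : Fin p → ℝ) {C : Set (Fin p → ℝ)}
    (hC : MeasurableSet C) :
    ‖posterior Xt h (Xt *ᵥ βs + w) C‖ₑ ≤
      (∫⁻ β in C, ENNReal.ofReal (Real.exp (logRatio Xt w (β - βs))) ∂(productPrior p h)) /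
        ∫⁻ β, ENNReal.ofReal (Real.exp (logRatio Xt w (β - βs))) ∂(productPrior p h) := by
  have h1 := setIntegral_likelihood_mul_priorDensity Xt hh w βs hC
  have h2 := setIntegral_likelihood_mul_priorDensity Xt hh w βs MeasurableSet.univ
  rw [Measure.restrict_univ, Measure.restrict_univ] at h2
  rw [posterior, h1, h2, mul_div_mul_left _ _ (likelihood_pos _ _ _).ne', ← ENNReal.toReal_div,
    Real.enorm_of_nonneg ENNReal.toReal_nonneg]
  exact ENNReal.ofReal_toReal_le

lemma enorm_posterior_le_one {m p : ℕ} (Xt : Matrix (Fin m) (Fin p) ℝ) {h : ℝ → ℝ}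
    (hh : IsProbDensity h) (w : Fin m → ℝ) (βs : Fin p → ℝ) {C : Set (Fin p → ℝ)}
    (hC : MeasurableSet C) : ‖posterior Xt h (Xt *ᵥ βs + w) C‖ₑ ≤ 1 :=
  (enorm_posterior_le Xt hh w βs hC).trans
    ((ENNReal.div_le_div_right (setLIntegral_le_lintegral _ _) _).trans ENNReal.div_self_le_one)

/-! ### The noise event -/

/-- The noise `w` has a controlled inner product with every sparse combination of the columns
of `Xt`. -/
def NoiseBounded {m p : ℕ} (Xt : Matrix (Fin m) (Fin p) ℝ) (w : Fin m → ℝ) (L : ℝ) : Prop :=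
  ∀ (S : Finset (Fin p)) (d : Fin p → ℝ), (∀ j ∉ S, d j = 0) →
    (w ⬝ᵥ (Xt *ᵥ d)) ^ 2 ≤ 24 * (S.card * L) * l2norm (Xt *ᵥ d) ^ 2

/-- Moving `Φ` across the inner product pairs `ε` with `Φᵀ Xt d`, which ranges over a space of
dimension at most `S.card`; the factor 2 in `hΦ` turns `12` into `24`. -/
lemma pi_gaussianReal_exists_sparse_gt {m n p : ℕ} {Φ : Matrix (Fin m) (Fin n) ℝ}
    (Xt : Matrix (Fin m) (Fin p) ℝ) (hΦ : ∀ v, l2norm (Φᵀ *ᵥ v) ^ 2 ≤ 2 * l2norm v ^ 2)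
    {L : ℝ} (hL : 0 ≤ L) (S : Finset (Fin p)) :
    (Measure.pi fun _ : Fin n => gaussianReal 0 1)
      {ε | ∃ d : Fin p → ℝ, (∀ j ∉ S, d j = 0) ∧ 24 * (S.card * L) * l2norm (Xt *ᵥ d) ^ 2 <
        ((Φ *ᵥ ε) ⬝ᵥ (Xt *ᵥ d)) ^ 2} ≤
      ENNReal.ofReal (√2 ^ S.card * Real.exp (-(12 * (S.card * L) / 4))) := by
  classical
  let f : Fin p → EuclideanSpace ℝ (Fin n) := fun j => WithLp.toLp 2 (Φᵀ *ᵥ Xt.col j)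
  let V : Submodule ℝ (EuclideanSpace ℝ (Fin n)) := Submodule.span ℝ (S.image f : Finset _)
  have hV : Module.finrank ℝ V ≤ S.card :=
    (finrank_span_finset_le_card _).trans Finset.card_image_le
  refine le_trans (measure_mono ?_) (pi_gaussianReal_exists_inner_sq_gt V hV (12 * (S.card * L)))
  rintro ε ⟨d, hd, hlt⟩
  refine ⟨WithLp.toLp 2 (Φᵀ *ᵥ (Xt *ᵥ d)), ?_, ?_⟩
  · have hsum : WithLp.toLp 2 (Φᵀ *ᵥ (Xt *ᵥ d)) = ∑ j ∈ S, d j • f j := by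
      rw [mulVec_eq_sum_smul Xt, Matrix.mulVec_sum]
      simp only [Matrix.mulVec_smul, f, ← WithLp.toLp_smul, ← WithLp.toLp_sum]
      congr 1
      exact (Finset.sum_subset (Finset.subset_univ _) fun j _ hj => by simp [hd j hj]).symm
    rw [hsum]
    refine Submodule.sum_mem _ fun j hj => Submodule.smul_mem _ _ (Submodule.subset_span ?_)
    exact Finset.mem_coe.2 (Finset.mem_image_of_mem f hj)
  · have h1 : (Φ *ᵥ ε) ⬝ᵥ (Xt *ᵥ d) = ε ⬝ᵥ (Φᵀ *ᵥ (Xt *ᵥ d)) := by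
      rw [Matrix.mulVec_transpose, dotProduct_comm, Matrix.dotProduct_mulVec, dotProduct_comm]
    rw [h1] at hlt
    refine lt_of_le_of_lt ?_ hlt
    have h2 := hΦ (Xt *ᵥ d)
    have h3 : 0 ≤ 12 * (S.card * L) := by positivity
    calc 12 * (S.card * L) * l2norm (Φᵀ *ᵥ (Xt *ᵥ d)) ^ 2
        ≤ 12 * (S.card * L) * (2 * l2norm (Xt *ᵥ d) ^ 2) := by gcongr
      _ = _ := by ring

/-- Union bound over all nonempty supports: the exponent gives `p^(-3)` per index, one factor `1/p`
absorbs `√2`, and the terms `p^(-2 |S|)` sum to `(1 + p^(-2))^p - 1`. The empty support forces `d =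
0` and cannot fail. -/
lemma pi_gaussianReal_not_noiseBounded {m n p : ℕ} {Φ : Matrix (Fin m) (Fin n) ℝ}
    (Xt : Matrix (Fin m) (Fin p) ℝ) (hΦ : ∀ v, l2norm (Φᵀ *ᵥ v) ^ 2 ≤ 2 * l2norm v ^ 2)
    (hp : 2 ≤ p) :
    (Measure.pi fun _ : Fin n => gaussianReal 0 1)
      {ε | ¬ NoiseBounded Xt (Φ *ᵥ ε) (Real.log p)} ≤
      ENNReal.ofReal (Real.exp (1 / p) - 1) := by
  classical
  have hp0 : (0 : ℝ) < p := by positivity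
  have hp2 : (2 : ℝ) ≤ p := by exact_mod_cast hp
  have hL : 0 ≤ Real.log p := Real.log_nonneg (by linarith)
  set x : ℝ := (p : ℝ)⁻¹ ^ 2 with hx
  have hterm : ∀ S : Finset (Fin p),
      √2 ^ S.card * Real.exp (-(12 * (S.card * Real.log p) / 4)) ≤ x ^ S.card := by
    intro S
    have h1 : Real.exp (-(12 * (S.card * Real.log p) / 4)) = ((p : ℝ)⁻¹ ^ 3) ^ S.card := by
      rw [show -(12 * (S.card * Real.log p) / 4) = S.card * (3 * (-Real.log p)) by ring,
        Real.exp_nat_mul, show (3 : ℝ) * (-Real.log p) = (3 : ℕ) * (-Real.log p) by norm_num,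
        Real.exp_nat_mul, Real.exp_neg, Real.exp_log hp0]
    rw [h1, ← mul_pow]
    gcongr
    rw [hx, pow_succ (p : ℝ)⁻¹ 2, ← mul_assoc, mul_comm (√2), mul_assoc]
    refine mul_le_of_le_one_right (by positivity) ?_
    rw [← div_eq_mul_inv, div_le_one hp0]
    refine le_trans ?_ hp2
    rw [Real.sqrt_le_left (by norm_num)]; norm_num
  have hsub : {ε : Fin n → ℝ | ¬ NoiseBounded Xt (Φ *ᵥ ε) (Real.log p)} ⊆
      ⋃ S ∈ (Finset.univ.erase (∅ : Finset (Fin p))),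
        {ε | ∃ d : Fin p → ℝ, (∀ j ∉ S, d j = 0) ∧
          24 * (S.card * Real.log p) * l2norm (Xt *ᵥ d) ^ 2 <
            ((Φ *ᵥ ε) ⬝ᵥ (Xt *ᵥ d)) ^ 2} := by
    intro ε hε
    simp only [NoiseBounded, Set.mem_ofPred_eq] at hε
    push Not at hε
    obtain ⟨S, d, hd, hlt⟩ := hε
    simp only [Set.mem_iUnion]
    refine ⟨S, Finset.mem_erase.2 ⟨?_, Finset.mem_univ _⟩, d, hd, hlt⟩
    rintro rfl
    have : d = 0 := by ext j; simpa using hd j (by simp)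
    subst this
    simp at hlt
  refine (measure_mono hsub).trans ((measure_biUnion_finset_le _ _).trans ?_)
  refine (Finset.sum_le_sum fun S _ => (pi_gaussianReal_exists_sparse_gt Xt hΦ hL S).trans
    (ENNReal.ofReal_le_ofReal (hterm S))).trans ?_
  rw [← ENNReal.ofReal_sum_of_nonneg fun _ _ => by positivity]
  refine ENNReal.ofReal_le_ofReal ?_
  have h2 : ∑ S ∈ (Finset.univ : Finset (Finset (Fin p))), x ^ S.card = (x + 1) ^ p := by
    have := Finset.sum_pow_mul_eq_add_pow x 1 (Finset.univ : Finset (Fin p))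
    simpa using this
  have h3 := Finset.add_sum_erase (Finset.univ : Finset (Finset (Fin p)))
    (fun S => x ^ S.card) (Finset.mem_univ ∅)
  rw [h2, Finset.card_empty, pow_zero] at h3
  have h4 : (x + 1) ^ p ≤ Real.exp (1 / p) := by
    calc (x + 1) ^ p ≤ Real.exp x ^ p := by
          gcongr
          exact Real.add_one_le_exp x
      _ = Real.exp (1 / p) := by
          rw [← Real.exp_nat_mul, hx]; congr 1; field_simp
  linarith

/-! ### Bounds on the log-likelihood ratio on the noise event -/

section logRatio
variable {m p : ℕ} {Xt : Matrix (Fin m) (Fin p) ℝ} {w : Fin m → ℝ} {L b r : ℝ}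

lemma NoiseBounded.abs_dotProduct_col_le (H : NoiseBounded Xt w L) (hL : 0 ≤ L)
    (hcol : ∀ j, l2norm (Xt.col j) ≤ 2 * √m) (j : Fin p) :
    |w ⬝ᵥ Xt.col j| ≤ 10 * √(m * L) := by
  have h1 := H {j} (Pi.single j 1) (fun i hi => by
    rw [Finset.mem_singleton] at hi; simp [hi])
  rw [Matrix.mulVec_single_one, Finset.card_singleton] at h1
  have h2 : l2norm (Xt.col j) ^ 2 ≤ 4 * (m : ℝ) := by
    calc l2norm (Xt.col j) ^ 2 ≤ (2 * √m) ^ 2 := by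
          gcongr
          · exact l2norm_nonneg _
          · exact hcol j
      _ = 4 * (m : ℝ) := by rw [mul_pow, Real.sq_sqrt (by positivity)]; norm_num
  -- A singleton support gives `24 · 4 = 96 ≤ 10²`.
  refine abs_le_of_sq_le_sq ?_ (by positivity)
  rw [mul_pow, Real.sq_sqrt (by positivity)]
  refine h1.trans ?_
  have h3 : 0 ≤ (m : ℝ) * L := by positivity
  calc 24 * (((1 : ℕ) : ℝ) * L) * l2norm (Xt.col j) ^ 2 ≤ 24 * (((1 : ℕ) : ℝ) * L) * (4 * m) := by
        gcongr
    _ ≤ _ := by push_cast; nlinarith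

lemma l2norm_mulVec_le_of_sum_abs_le (hcol : ∀ j, l2norm (Xt.col j) ≤ 2 * √m)
    (hr : r * √m ≤ √b) {σ : Fin p → ℝ} (hσ : ∑ j, |σ j| ≤ r) :
    l2norm (Xt *ᵥ σ) ≤ 2 * √b := by
  refine (l2norm_mulVec_le Xt hcol σ).trans ?_
  have := mul_le_mul_of_nonneg_right hσ (Real.sqrt_nonneg m)
  linarith

/-- For perturbations `σ` that are tiny but not sparse: the `ℓ¹` norm times the worst single column
replaces the bound by supports. It is applied with `b = s log p` and `r = baseRate`, where `r √m =
√b`. -/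
lemma NoiseBounded.abs_dotProduct_mulVec_le (H : NoiseBounded Xt w L) (hL : 0 ≤ L) (hb : L ≤ b)
    (hcol : ∀ j, l2norm (Xt.col j) ≤ 2 * √m) (hr : r * √m ≤ √b) {σ : Fin p → ℝ}
    (hσ : ∑ j, |σ j| ≤ r) : |w ⬝ᵥ (Xt *ᵥ σ)| ≤ 10 * b := by
  refine (SketchedRegression.abs_dotProduct_mulVec_le Xt w (H.abs_dotProduct_col_le hL hcol)
    σ).trans ?_
  rw [Real.sqrt_mul (by positivity)]
  have h1 : √L ≤ √b := Real.sqrt_le_sqrt hb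
  have h2 := mul_le_mul_of_nonneg_right hσ (Real.sqrt_nonneg m)
  calc (∑ j, |σ j|) * (10 * (√m * √L)) = 10 * (((∑ j, |σ j|) * √m) * √L) := by ring
    _ ≤ 10 * (√b * √b) := by
        gcongr
        linarith
    _ = 10 * b := by rw [Real.mul_self_sqrt (hL.trans hb)]

/-- The noise term costs at most `10 b` and the quadratic term `(2√b)² / 2 = 2 b`. -/
lemma NoiseBounded.logRatio_ge (H : NoiseBounded Xt w L) (hL : 0 ≤ L) (hb : L ≤ b)
    (hcol : ∀ j, l2norm (Xt.col j) ≤ 2 * √m) (hr : r * √m ≤ √b) {d : Fin p → ℝ}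
    (hd : ∑ j, |d j| ≤ r) : -(12 * b) ≤ logRatio Xt w d := by
  have h1 := (abs_le.1 (H.abs_dotProduct_mulVec_le hL hb hcol hr hd)).1
  have h2 : l2norm (Xt *ᵥ d) ^ 2 ≤ (2 * √b) ^ 2 := by
    gcongr
    · exact l2norm_nonneg _
    · exact l2norm_mulVec_le_of_sum_abs_le hcol hr hd
  rw [mul_pow, Real.sq_sqrt (hL.trans hb)] at h2
  rw [logRatio]
  linarith

/-- On the noise event the log-likelihood ratio is negative at every `β` whose signal is large
compared to the number of its large entries. -/
lemma NoiseBounded.logRatio_le (H : NoiseBounded Xt w L) (hL : 0 ≤ L) (hb : L ≤ b)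
    (hcol : ∀ j, l2norm (Xt.col j) ≤ 2 * √m) (hr : r * √m ≤ √b) {S : Finset (Fin p)}
    (hS : b ≤ S.card * L) {d σ : Fin p → ℝ} (hd : ∀ j ∉ S, d j = σ j)
    (hσ : ∑ j, |σ j| ≤ r) (hlarge : 400 * (S.card * L) ≤ l2norm (Xt *ᵥ d) ^ 2) :
    logRatio Xt w d ≤ -(l2norm (Xt *ᵥ d) ^ 2 / 5) := by
  set κ : ℝ := S.card * L with hκ
  have hb0 : 0 ≤ b := hL.trans hb
  have hκ0 : 0 ≤ κ := hb0.trans hS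
  set v := l2norm (Xt *ᵥ d) with hv
  have hv0 : 0 ≤ v := l2norm_nonneg _
  have hsq := Real.sq_sqrt hκ0
  have hs0 := Real.sqrt_nonneg κ
  have hkv : √κ ≤ v / 20 := by
    refine abs_le_of_sq_le_sq' ?_ (by positivity) |>.2
    rw [hsq]; linarith
  have hbκ : √b ≤ √κ := Real.sqrt_le_sqrt hS
  have h1 := l2norm_mulVec_le_of_sum_abs_le hcol hr hσ
  have h2 := (abs_le.1 (H.abs_dotProduct_mulVec_le hL hb hcol hr hσ)).2
  have h3 := H S (d - σ) (fun j hj => by simp [hd j hj])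
  have h4 : l2norm (Xt *ᵥ (d - σ)) ≤ v + 2 * √κ := by
    have h5 := l2norm_add_le (Xt *ᵥ d) ((-1 : ℝ) • (Xt *ᵥ σ))
    rw [l2norm_smul, abs_neg, abs_one, one_mul] at h5
    have h6 : Xt *ᵥ (d - σ) = Xt *ᵥ d + (-1 : ℝ) • (Xt *ᵥ σ) := by
      rw [Matrix.mulVec_sub, neg_one_smul, sub_eq_add_neg]
    rw [h6]
    linarith
  have h7 : w ⬝ᵥ (Xt *ᵥ (d - σ)) ≤ 5 * √κ * (v + 2 * √κ) := by
    refine abs_le_of_sq_le_sq' ?_ (by positivity) |>.2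
    refine h3.trans ?_
    rw [mul_pow, mul_pow, hsq]
    have := l2norm_nonneg (Xt *ᵥ (d - σ))
    gcongr
    norm_num
  have h8 : w ⬝ᵥ (Xt *ᵥ d) = w ⬝ᵥ (Xt *ᵥ (d - σ)) + w ⬝ᵥ (Xt *ᵥ σ) := by
    rw [← dotProduct_add, ← Matrix.mulVec_add, sub_add_cancel]
  rw [logRatio, ← hv, h8]
  -- With `√κ ≤ v / 20` and `b ≤ κ`, the sparse part of the noise term is at most `v²/4 + v²/40` and
  -- the small part at most `v²/40`; subtracting `v²/2` leaves `-v²/5`.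
  have h9 : √κ * v ≤ v / 20 * v := mul_le_mul_of_nonneg_right hkv hv0
  nlinarith

end logRatio

/-! ### Prior mass bounds -/

lemma mem_activeSet {p : ℕ} {β : Fin p → ℝ} {j : Fin p} : j ∈ activeSet β ↔ β j ≠ 0 := by
  simp [activeSet]

open Classical in
/-- The indices of the entries of `β` of absolute value at least `a`. -/
noncomputable def largeEntries {p : ℕ} (a : ℝ) (β : Fin p → ℝ) : Finset (Fin p) :=
  Finset.univ.filter fun j => a ≤ |β j|

lemma mem_largeEntries {p : ℕ} {a : ℝ} {β : Fin p → ℝ} {j : Fin p} :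
    j ∈ largeEntries a β ↔ a ≤ |β j| := by simp [largeEntries]

lemma mem_manyLargeSet {p k : ℕ} {a : ℝ} {β : Fin p → ℝ} :
    β ∈ manyLargeSet p k a ↔ k ≤ (largeEntries a β).card := by
  rw [manyLargeSet, Set.mem_ofPred_eq]
  have : {j | a ≤ |β j|} = (largeEntries a β : Set (Fin p)) := by
    ext j; simp [mem_largeEntries]
  rw [this, Set.ncard_coe_finset]

lemma measurable_card_largeEntries {p : ℕ} (a : ℝ) :
    Measurable fun β : Fin p → ℝ => (largeEntries a β).card := by
  classical
  simp only [largeEntries, Finset.card_filter]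
  refine Finset.measurable_fun_sum _ fun j _ => ?_
  exact Measurable.ite (measurableSet_le measurable_const (by fun_prop)) measurable_const
    measurable_const

lemma measurable_card_largeEntries_union {p : ℕ} (a : ℝ) (T : Finset (Fin p)) :
    Measurable fun β : Fin p → ℝ => (largeEntries a β ∪ T).card := by
  classical
  have h : ∀ β : Fin p → ℝ, (largeEntries a β ∪ T).card =
      ∑ j, if a ≤ |β j| ∨ j ∈ T then 1 else 0 := by
    intro β
    rw [← Finset.card_filter]
    congr 1
    ext j
    simp [mem_largeEntries]
  simp only [h]
  refine Finset.measurable_fun_sum _ fun j _ => ?_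
  refine Measurable.ite ?_ measurable_const measurable_const
  have hm : MeasurableSet {β : Fin p → ℝ | a ≤ |β j|} :=
    measurableSet_le measurable_const (by fun_prop)
  exact hm.union (MeasurableSet.const _)

lemma measurableSet_manyLargeSet (p k : ℕ) (a : ℝ) : MeasurableSet (manyLargeSet p k a) := by
  have : manyLargeSet p k a = {β | k ≤ (largeEntries a β).card} := by
    ext β; exact mem_manyLargeSet
  rw [this]
  exact measurableSet_le measurable_const (measurable_card_largeEntries a)

lemma mem_farSet {p : ℕ} {βs β : Fin p → ℝ} {θ : ℝ} :
    β ∈ farSet βs θ ↔ 3 * θ < l2norm (β - βs) := Iff.rfl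

lemma measurableSet_farSet {p : ℕ} (βs : Fin p → ℝ) (θ : ℝ) : MeasurableSet (farSet βs θ) := by
  have h : Measurable fun β : Fin p → ℝ => l2norm (β - βs) :=
    (continuous_l2norm.comp (continuous_id.sub continuous_const)).measurable
  exact measurableSet_lt measurable_const h

namespace IsProbDensity
variable {h : ℝ → ℝ}

lemma marginalPrior_Icc_neg (hh : IsProbDensity h) {a t : ℝ} (ha : 0 ≤ a)
    (ht : 1 - ∫ x in (-a)..a, h x ≤ t) :
    ENNReal.ofReal (1 - t) ≤ marginalPrior h (Set.Icc (-a) a) := by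
  rw [hh.marginalPrior_apply measurableSet_Icc, integral_Icc_eq_integral_Ioc,
    ← intervalIntegral.integral_of_le (by linarith)]
  exact ENNReal.ofReal_le_ofReal (by linarith)

lemma marginalPrior_le_abs (hh : IsProbDensity h) {a t : ℝ} (ha : 0 ≤ a)
    (ht : 1 - ∫ x in (-a)..a, h x ≤ t) :
    marginalPrior h {x | a ≤ |x|} ≤ ENNReal.ofReal t := by
  have hm : MeasurableSet {x : ℝ | a ≤ |x|} := measurableSet_le measurable_const (by fun_prop)
  rw [hh.marginalPrior_apply hm]
  refine ENNReal.ofReal_le_ofReal ?_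
  have h1 : {x : ℝ | a ≤ |x|}ᶜ = Set.Ioo (-a) a := by
    ext x; simp [abs_lt]
  have h2 := integral_add_compl hm hh.integrable
  rw [h1, hh.integral_eq_one, ← integral_Ioc_eq_integral_Ioo,
    ← intervalIntegral.integral_of_le (by linarith)] at h2
  linarith

lemma marginalPrior_Icc (hh : IsProbDensity h) {c a g M : ℝ} (ha : 0 ≤ a)
    (hg : ∀ x, |x| ≤ M → g ≤ h x) (hc : |c| + a ≤ M) :
    ENNReal.ofReal (2 * a * g) ≤ marginalPrior h (Set.Icc (c - a) (c + a)) := by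
  rw [hh.marginalPrior_apply measurableSet_Icc]
  refine ENNReal.ofReal_le_ofReal ?_
  have h1 : ∫ _x in Set.Icc (c - a) (c + a), g = 2 * a * g := by
    rw [setIntegral_const, measureReal_def, Real.volume_Icc,
      ENNReal.toReal_ofReal (by linarith), smul_eq_mul]
    ring
  rw [← h1]
  refine setIntegral_mono_on (by simp) hh.integrable.integrableOn measurableSet_Icc ?_
  intro x hx
  refine hg x (le_trans ?_ hc)
  have : |x - c| ≤ a := abs_le.2 ⟨by linarith [hx.1], by linarith [hx.2]⟩
  calc |x| = |c + (x - c)| := by rw [add_sub_cancel]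
    _ ≤ |c| + |x - c| := abs_add_le _ _
    _ ≤ |c| + a := by linarith

/-- Each active coordinate contributes at least `2 a g`, each inactive one `1 - t`; Bernoulli's
inequality bounds the latter product. -/
lemma productPrior_box_ge (hh : IsProbDensity h) {p : ℕ} {βs : Fin p → ℝ} {a g M t : ℝ}
    (ha : 0 ≤ a) (hg0 : 0 ≤ g) (hg : ∀ x, |x| ≤ M → g ≤ h x)
    (hβs : ∀ j ∈ activeSet βs, |βs j| + a ≤ M)
    (ht : 1 - ∫ x in (-a)..a, h x ≤ t) (ht0 : 0 ≤ t) (ht1 : t ≤ 1) :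
    ENNReal.ofReal ((2 * a * g) ^ sparsity βs * (1 - p * t)) ≤
      productPrior p h {β | ∀ j, |β j - βs j| ≤ a} := by
  classical
  have := hh.isProbabilityMeasure_marginalPrior
  have hset : {β : Fin p → ℝ | ∀ j, |β j - βs j| ≤ a} =
      Set.univ.pi fun j => Set.Icc (βs j - a) (βs j + a) := by
    ext β
    simp only [Set.mem_ofPred_eq, Set.mem_pi, Set.mem_univ, true_imp_iff, Set.mem_Icc]
    refine forall_congr' fun j => ?_
    rw [abs_le]
    constructor <;> intro ⟨h1, h2⟩ <;> constructor <;> linarith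
  rw [hset, productPrior, Measure.pi_pi,
    ← Finset.prod_mul_prod_compl (activeSet βs) (fun j => marginalPrior h _),
    ENNReal.ofReal_mul (by positivity)]
  refine mul_le_mul' ?_ ?_
  · rw [ENNReal.ofReal_pow (by positivity), sparsity, ← Finset.prod_const]
    exact Finset.prod_le_prod' fun j hj => hh.marginalPrior_Icc ha hg (hβs j hj)
  · have h1 : ∀ j ∈ (activeSet βs)ᶜ, ENNReal.ofReal (1 - t) ≤
        marginalPrior h (Set.Icc (βs j - a) (βs j + a)) := by
      intro j hj
      have hj0 : βs j = 0 := by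
        rw [Finset.mem_compl, mem_activeSet, not_not] at hj; exact hj
      rw [hj0, zero_sub, zero_add]
      exact hh.marginalPrior_Icc_neg ha ht
    refine le_trans ?_ (Finset.prod_le_prod' h1)
    rw [Finset.prod_const, ← ENNReal.ofReal_pow (by linarith)]
    refine ENNReal.ofReal_le_ofReal ?_
    have h2 : 1 + (p : ℝ) * (-t) ≤ (1 + (-t)) ^ p := one_add_mul_le_pow (by linarith) p
    calc 1 - p * t ≤ (1 - t) ^ p := by
          rw [← sub_eq_add_neg] at h2; linarith
      _ ≤ (1 - t) ^ ((activeSet βs)ᶜ.card) := by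
          refine pow_le_pow_of_le_one (by linarith) (by linarith) ?_
          exact (Finset.card_le_univ _).trans (by simp)

/-- The coordinates are independent under the prior, and each contributes a factor of at most `1 + Q
t`. -/
lemma lintegral_pow_card_largeEntries_le (hh : IsProbDensity h) (p : ℕ) {a t Q : ℝ} (hQ : 1 ≤ Q)
    (ha : 0 ≤ a) (ht0 : 0 ≤ t) (ht : 1 - ∫ x in (-a)..a, h x ≤ t) :
    ∫⁻ β, ENNReal.ofReal (Q ^ (largeEntries a β).card) ∂(productPrior p h) ≤
      ENNReal.ofReal (Real.exp (p * (Q * t))) := by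
  classical
  have := hh.isProbabilityMeasure_marginalPrior
  have hm : MeasurableSet {x : ℝ | a ≤ |x|} := measurableSet_le measurable_const (by fun_prop)
  have h1 : ∀ β : Fin p → ℝ, ENNReal.ofReal (Q ^ (largeEntries a β).card) =
      ∏ j, (if a ≤ |β j| then ENNReal.ofReal Q else 1) := by
    intro β
    rw [Finset.prod_ite, Finset.prod_const, Finset.prod_const_one, mul_one,
      ENNReal.ofReal_pow (by linarith), largeEntries]
  simp_rw [h1]
  rw [productPrior, lintegral_pi_prod _ (fun _ x => if a ≤ |x| then ENNReal.ofReal Q else 1)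
    (fun _ => Measurable.ite hm measurable_const measurable_const), Finset.prod_const,
    Finset.card_univ, Fintype.card_fin]
  have h2 : ∫⁻ x, (if a ≤ |x| then ENNReal.ofReal Q else 1) ∂(marginalPrior h) ≤
      ENNReal.ofReal (1 + Q * t) := by
    calc ∫⁻ x, (if a ≤ |x| then ENNReal.ofReal Q else 1) ∂(marginalPrior h)
        ≤ ∫⁻ x, (1 + {x : ℝ | a ≤ |x|}.indicator (fun _ => ENNReal.ofReal Q) x)
            ∂(marginalPrior h) := by
          refine lintegral_mono fun x => ?_
          by_cases hx : a ≤ |x|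
          · simp [hx]
          · simp [hx]
      _ = 1 + ENNReal.ofReal Q * marginalPrior h {x | a ≤ |x|} := by
          rw [lintegral_add_left measurable_const, lintegral_indicator hm]
          simp
      _ ≤ 1 + ENNReal.ofReal Q * ENNReal.ofReal t := by
          gcongr
          exact hh.marginalPrior_le_abs ha ht
      _ = _ := by
          rw [← ENNReal.ofReal_mul (by linarith), ENNReal.ofReal_add (by norm_num) (by positivity),
            ENNReal.ofReal_one]
  refine (pow_le_pow_left' h2 p).trans ?_
  rw [← ENNReal.ofReal_pow (by positivity)]
  refine ENNReal.ofReal_le_ofReal ?_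
  calc (1 + Q * t) ^ p ≤ Real.exp (Q * t) ^ p := by
        gcongr
        linarith [Real.add_one_le_exp (Q * t)]
    _ = _ := by rw [← Real.exp_nat_mul]

/-- The exponential moment of the number of large entries on the event that there are many. -/
lemma setLIntegral_pow_card_largeEntries_le (hh : IsProbDensity h) (p k : ℕ) {a t Q : ℝ}
    (hQ : 1 ≤ Q) (ha : 0 ≤ a) (ht0 : 0 ≤ t) (ht : 1 - ∫ x in (-a)..a, h x ≤ t) :
    ∫⁻ β in manyLargeSet p k a, ENNReal.ofReal (Q ^ (largeEntries a β).card)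
        ∂(productPrior p h) ≤
      ENNReal.ofReal (Real.exp (p * (Q ^ 2 * t)) / Q ^ k) := by
  -- Chernoff: where the count is at least `k`, a spare factor `Q ^ count / Q ^ k ≥ 1` is available.
  have h1 : ∀ β ∈ manyLargeSet p k a, ENNReal.ofReal (Q ^ (largeEntries a β).card) ≤
      ENNReal.ofReal ((Q ^ k)⁻¹) * ENNReal.ofReal ((Q ^ 2) ^ (largeEntries a β).card) := by
    intro β hβ
    rw [← ENNReal.ofReal_mul (by positivity)]
    refine ENNReal.ofReal_le_ofReal ?_
    rw [inv_mul_eq_div, le_div_iff₀ (by positivity), pow_right_comm, sq]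
    gcongr
    exact mem_manyLargeSet.1 hβ
  refine (setLIntegral_mono' (measurableSet_manyLargeSet p k a) h1).trans ?_
  refine (setLIntegral_le_lintegral _ _).trans ?_
  rw [lintegral_const_mul' _ _ ENNReal.ofReal_ne_top, div_eq_inv_mul,
    ENNReal.ofReal_mul (by positivity)]
  gcongr
  exact hh.lintegral_pow_card_largeEntries_le p (one_le_pow₀ hQ) ha ht0 ht

end IsProbDensity

/-! ### The finite-sample bound -/

lemma baseRate_mul_sqrt {s p m : ℕ} (hm : 0 < m) :
    baseRate s p m * √m = √(s * Real.log p) := by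
  have hm' : (0 : ℝ) < m := by exact_mod_cast hm
  rw [baseRate, ← Real.sqrt_mul' _ hm'.le, div_mul_cancel₀ _ hm'.ne']

lemma mul_threshold {s p m : ℕ} (hp : 0 < p) : p * threshold s p m = baseRate s p m := by
  have hp' : (0 : ℝ) < p := by exact_mod_cast hp
  rw [threshold, mul_div_cancel₀ _ hp'.ne']

lemma baseRate_nonneg (s p m : ℕ) : 0 ≤ baseRate s p m := Real.sqrt_nonneg _

lemma threshold_nonneg (s p m : ℕ) : 0 ≤ threshold s p m :=
  div_nonneg (baseRate_nonneg s p m) (Nat.cast_nonneg p)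

/-- The reason for the division by `p` in `threshold`: all coordinates below it together have `ℓ¹`
norm at most `baseRate`. -/
lemma sum_abs_le_baseRate {s p m : ℕ} (hp : 0 < p) {d : Fin p → ℝ}
    (hd : ∀ j, |d j| ≤ threshold s p m) : ∑ j, |d j| ≤ baseRate s p m := by
  calc ∑ j, |d j| ≤ ∑ _j : Fin p, threshold s p m := Finset.sum_le_sum fun j _ => hd j
    _ = baseRate s p m := by
        rw [Finset.sum_const, Finset.card_univ, Fintype.card_fin, nsmul_eq_mul, mul_threshold hp]

open Classical in
/-- The part of `β - βs` outside of the support of `βs` and of the large entries of `β`. -/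
noncomputable def smallPart {p : ℕ} (a : ℝ) (βs β : Fin p → ℝ) : Fin p → ℝ :=
  fun j => if j ∈ largeEntries a β ∪ activeSet βs then 0 else β j - βs j

lemma abs_smallPart_le {p : ℕ} {a : ℝ} (ha : 0 ≤ a) (βs β : Fin p → ℝ) (j : Fin p) :
    |smallPart a βs β j| ≤ a := by
  unfold smallPart
  split_ifs with hj
  · simpa using ha
  · rw [Finset.mem_union, mem_largeEntries, mem_activeSet] at hj
    push Not at hj
    rw [hj.2, sub_zero]
    exact hj.1.le

section finiteSample
variable {n m p A : ℕ} {Xt : Matrix (Fin m) (Fin p) ℝ} {w : Fin m → ℝ} {βs β : Fin p → ℝ}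

lemma log_le_sparsity_mul_log (hs : 1 ≤ sparsity βs) :
    Real.log p ≤ sparsity βs * Real.log p := by
  have hL : 0 ≤ Real.log p := Real.log_natCast_nonneg p
  have : (1 : ℝ) ≤ sparsity βs := by exact_mod_cast hs
  nlinarith

lemma sparsity_mul_log_le [DecidableEq (Fin p)] (a : ℝ) (β : Fin p → ℝ) :
    sparsity βs * Real.log p ≤
      (largeEntries a β ∪ activeSet βs).card * Real.log p := by
  have hL : 0 ≤ Real.log p := Real.log_natCast_nonneg p
  gcongr
  exact Finset.card_le_card Finset.subset_union_right

lemma NoiseBounded.logRatio_le_of_large [DecidableEq (Fin p)]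
    (H : NoiseBounded Xt w (Real.log p)) (hp : 2 ≤ p) (hm : 0 < m)
    (hs : 1 ≤ sparsity βs) (hcol : ∀ j, l2norm (Xt.col j) ≤ 2 * √m)
    (hlarge : 400 * ((largeEntries (threshold (sparsity βs) p m) β ∪ activeSet βs).card *
      Real.log p) ≤ l2norm (Xt *ᵥ (β - βs)) ^ 2) :
    logRatio Xt w (β - βs) ≤ -(l2norm (Xt *ᵥ (β - βs)) ^ 2 / 5) := by
  refine H.logRatio_le (Real.log_natCast_nonneg p) (log_le_sparsity_mul_log hs) hcol
    (baseRate_mul_sqrt hm).le (sparsity_mul_log_le _ β)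
    (σ := smallPart (threshold (sparsity βs) p m) βs β) ?_ ?_ hlarge
  · intro j hj
    unfold smallPart
    rw [if_neg]
    · rfl
    · convert hj
  · exact sum_abs_le_baseRate (by omega) (abs_smallPart_le (threshold_nonneg _ _ _) βs β)

/-- Removing the small part, of norm at most `r ≤ E r`, leaves a vector of norm at least `2 E r`
supported on at most `(A + 1) s` indices. The restricted eigenvalue gives it a signal of `(E √η / 4)
√b`, and restoring the small part costs `2 √b`; hence the constant `E √η / 4 - 2`. -/
lemma NoiseBounded.logRatio_le_of_mem_farSet
    (H : NoiseBounded Xt w (Real.log p)) (hp : 2 ≤ p) (hm : 0 < m)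
    (hs : 1 ≤ sparsity βs) (hcol : ∀ j, l2norm (Xt.col j) ≤ 2 * √m) {η E c : ℝ}
    (hRE : ∀ S : Finset (Fin p), activeSet βs ⊆ S → S.card ≤ (A + 1) * sparsity βs →
      ∀ x : Fin p → ℝ, (∀ j ∉ S, x j = 0) → √(m * η) / 8 * l2norm x ≤ l2norm (Xt *ᵥ x))
    (hE : 1 ≤ E) (hD0 : 0 ≤ E * √η / 4 - 2) (hD₁ : 400 * ((A : ℝ) + 1) ≤ (E * √η / 4 - 2) ^ 2)
    (hD₂ : 5 * c ≤ (E * √η / 4 - 2) ^ 2)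
    (hfar : β ∈ farSet βs (E * baseRate (sparsity βs) p m))
    (hmany : β ∉ manyLargeSet p (A * sparsity βs) (threshold (sparsity βs) p m)) :
    logRatio Xt w (β - βs) ≤ -(c * (sparsity βs * Real.log p)) := by
  classical
  set s := sparsity βs with hsdef
  set a := threshold s p m with ha
  set r := baseRate s p m with hr
  set b : ℝ := s * Real.log p with hb
  set D := E * √η / 4 - 2 with hD
  set S := largeEntries a β ∪ activeSet βs with hS
  set σ := smallPart a βs β with hσ
  have hL : 0 ≤ Real.log p := Real.log_natCast_nonneg p
  have hb0 : 0 ≤ b := by positivity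
  have hr0 : 0 ≤ r := baseRate_nonneg _ _ _
  have hrm : r * √m = √b := baseRate_mul_sqrt hm
  have hσ1 : ∑ j, |σ j| ≤ r :=
    sum_abs_le_baseRate (by omega) (abs_smallPart_le (threshold_nonneg _ _ _) βs β)
  have hScard : S.card ≤ (A + 1) * s := by
    rw [mem_manyLargeSet] at hmany
    refine (Finset.card_union_le _ _).trans ?_
    change _ + s ≤ _
    linarith
  have hx0 : ∀ j ∉ S, (β - βs - σ) j = 0 := by
    intro j hj
    have : σ j = β j - βs j := by
      rw [hσ]; unfold smallPart; rw [if_neg]; convert hj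
    simp [this]
  have h1 := hRE S Finset.subset_union_right hScard _ hx0
  have h2 : l2norm (β - βs) ≤ l2norm (β - βs - σ) + l2norm σ := by
    simpa using l2norm_add_le (β - βs - σ) σ
  have h3 := (l2norm_le_sum_abs σ).trans hσ1
  rw [mem_farSet] at hfar
  have h4 : 2 * E * r ≤ l2norm (β - βs - σ) := by nlinarith
  have h5 : E * √η / 4 * √b ≤ l2norm (Xt *ᵥ (β - βs - σ)) := by
    refine le_trans (le_of_eq ?_) ((mul_le_mul_of_nonneg_left h4 (by positivity)).trans h1)
    rw [← hrm, Real.sqrt_mul (Nat.cast_nonneg m)]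
    ring
  have h6 := l2norm_mulVec_le_of_sum_abs_le hcol hrm.le hσ1
  have h7 : l2norm (Xt *ᵥ (β - βs - σ)) ≤ l2norm (Xt *ᵥ (β - βs)) + l2norm (Xt *ᵥ σ) := by
    have h8 := l2norm_add_le (Xt *ᵥ (β - βs)) ((-1 : ℝ) • (Xt *ᵥ σ))
    rw [l2norm_smul, abs_neg, abs_one, one_mul, neg_one_smul, ← sub_eq_add_neg,
      ← Matrix.mulVec_sub] at h8
    exact h8
  have h9 : D * √b ≤ l2norm (Xt *ᵥ (β - βs)) := by rw [hD]; linarith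
  have h10 : D ^ 2 * b ≤ l2norm (Xt *ᵥ (β - βs)) ^ 2 := by
    calc D ^ 2 * b = (D * √b) ^ 2 := by rw [mul_pow, Real.sq_sqrt hb0]
      _ ≤ _ := by gcongr
  have h11 : (S.card : ℝ) * Real.log p ≤ (A + 1) * b := by
    rw [hb, ← mul_assoc]
    gcongr
    exact_mod_cast hScard
  have h12 := H.logRatio_le_of_large (β := β) hp hm hs hcol (by
    have := mul_le_mul_of_nonneg_right hD₁ hb0
    rw [← hsdef, ← ha, ← hS]
    linarith)
  have h13 := mul_le_mul_of_nonneg_right hD₂ hb0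
  linarith

lemma NoiseBounded.le_lintegral_exp_logRatio
    (H : NoiseBounded Xt w (Real.log p)) (hp : 0 < p) (hm : 0 < m)
    (hs : 1 ≤ sparsity βs) (hcol : ∀ j, l2norm (Xt.col j) ≤ 2 * √m) {K : ℝ}
    {ν : Measure (Fin p → ℝ)}
    (hbox : ENNReal.ofReal (Real.exp (-(K * (sparsity βs * Real.log p)))) ≤
      ν {β | ∀ j, |β j - βs j| ≤ threshold (sparsity βs) p m}) :
    ENNReal.ofReal (Real.exp (-((12 + K) * (sparsity βs * Real.log p)))) ≤
      ∫⁻ β, ENNReal.ofReal (Real.exp (logRatio Xt w (β - βs))) ∂ν := by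
  set b : ℝ := sparsity βs * Real.log p with hb
  set B := {β : Fin p → ℝ | ∀ j, |β j - βs j| ≤ threshold (sparsity βs) p m} with hB
  have hBm : MeasurableSet B := by
    rw [hB, Set.ofPred_forall]
    exact MeasurableSet.iInter fun j => measurableSet_le (by fun_prop) measurable_const
  calc ENNReal.ofReal (Real.exp (-((12 + K) * b)))
      = ENNReal.ofReal (Real.exp (-(12 * b))) * ENNReal.ofReal (Real.exp (-(K * b))) := by
        rw [← ENNReal.ofReal_mul (Real.exp_pos _).le, ← Real.exp_add]; congr 2; ring
    _ ≤ ENNReal.ofReal (Real.exp (-(12 * b))) * ν B := by gcongr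
    _ = ∫⁻ _β in B, ENNReal.ofReal (Real.exp (-(12 * b))) ∂ν := by rw [setLIntegral_const]
    _ ≤ ∫⁻ β in B, ENNReal.ofReal (Real.exp (logRatio Xt w (β - βs))) ∂ν := by
        refine setLIntegral_mono' hBm fun β hβ => ENNReal.ofReal_le_ofReal (Real.exp_le_exp.2 ?_)
        exact H.logRatio_ge (Real.log_natCast_nonneg p) (log_le_sparsity_mul_log hs) hcol
          (baseRate_mul_sqrt hm).le (sum_abs_le_baseRate hp hβ)
    _ ≤ _ := setLIntegral_le_lintegral _ _

/-- The Gaussian moment generating function gives `exp ((‖Φᵀ Xt d‖² - ‖Xt d‖²) / 2)`; for an exact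
identity covariance this mean would be 1. -/
lemma lintegral_exp_logRatio_le {Φ : Matrix (Fin m) (Fin n) ℝ} {τ : ℝ}
    (hΦ : ∀ v, l2norm (Φᵀ *ᵥ v) ^ 2 ≤ (1 + τ) * l2norm v ^ 2) (d : Fin p → ℝ) :
    ∫⁻ ε, ENNReal.ofReal (Real.exp (logRatio Xt (Φ *ᵥ ε) d))
        ∂(Measure.pi fun _ : Fin n => gaussianReal 0 1) ≤
      ENNReal.ofReal (Real.exp (τ * l2norm (Xt *ᵥ d) ^ 2 / 2)) := by
  have h1 : ∀ ε : Fin n → ℝ, ENNReal.ofReal (Real.exp (logRatio Xt (Φ *ᵥ ε) d)) =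
      ENNReal.ofReal (Real.exp (-(l2norm (Xt *ᵥ d) ^ 2 / 2))) *
        ENNReal.ofReal (Real.exp ((Φᵀ *ᵥ (Xt *ᵥ d)) ⬝ᵥ ε)) := by
    intro ε
    rw [← ENNReal.ofReal_mul (Real.exp_pos _).le, ← Real.exp_add, logRatio,
      Matrix.mulVec_transpose, ← Matrix.dotProduct_mulVec, dotProduct_comm (Φ *ᵥ ε)]
    congr 2
    ring
  simp_rw [h1]
  rw [lintegral_const_mul' _ _ ENNReal.ofReal_ne_top, lintegral_exp_dotProduct, ← l2norm_sq,
    ← ENNReal.ofReal_mul (Real.exp_pos _).le, ← Real.exp_add]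
  refine ENNReal.ofReal_le_ofReal (Real.exp_le_exp.2 ?_)
  linarith [hΦ (Xt *ᵥ d)]

/-- The expected posterior mass of the complement of the contraction neighbourhood, for a sketching
matrix with good deterministic properties. -/
theorem enorm_expectedPosterior_le {Φ : Matrix (Fin m) (Fin n) ℝ}
    {X : Matrix (Fin n) (Fin p) ℝ} {h : ℝ → ℝ} (hh : IsProbDensity h) {η E K u τ : ℝ}
    (hp : 2 ≤ p) (hm : 0 < m) (hs : 1 ≤ sparsity βs)
    (hΦ : ∀ v, l2norm (Φᵀ *ᵥ v) ^ 2 ≤ (1 + τ) * l2norm v ^ 2) (hτ0 : 0 ≤ τ) (hτ1 : τ ≤ 1)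
    (hu : 0 < u) (hτ : 200 * τ ≤ u / 2)
    (hcol : ∀ j, l2norm ((Φ * X).col j) ≤ 2 * √m)
    (hRE : ∀ S : Finset (Fin p), activeSet βs ⊆ S → S.card ≤ (A + 1) * sparsity βs →
      ∀ x : Fin p → ℝ, (∀ j ∉ S, x j = 0) → √(m * η) / 8 * l2norm x ≤ l2norm ((Φ * X) *ᵥ x))
    (ht : 1 - ∫ x in (-(threshold (sparsity βs) p m))..(threshold (sparsity βs) p m), h x ≤
      (p : ℝ) ^ (-(1 + u)))
    (hbox : ENNReal.ofReal (Real.exp (-(K * (sparsity βs * Real.log p)))) ≤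
      productPrior p h {β | ∀ j, |β j - βs j| ≤ threshold (sparsity βs) p m})
    (hE : 1 ≤ E) (hD0 : 0 ≤ E * √η / 4 - 2) (hD₁ : 400 * ((A : ℝ) + 1) ≤ (E * √η / 4 - 2) ^ 2)
    (hD₂ : 5 * (13 + K) ≤ (E * √η / 4 - 2) ^ 2) (hA : 13 + K ≤ u / 2 * (A - 1)) :
    ‖expectedPosterior Φ X βs h (farSet βs (E * baseRate (sparsity βs) p m) ∪
      manyLargeSet p (A * sparsity βs) (threshold (sparsity βs) p m))‖ₑ ≤
      ENNReal.ofReal (Real.exp (1 / p) - 1 + 7 / p) := by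
  classical
  have := hh.isProbabilityMeasure_productPrior p
  set s := sparsity βs with hsdef
  set a := threshold s p m with ha
  set b : ℝ := s * Real.log p with hb
  set ν := productPrior p h with hν
  set C₁ := farSet βs (E * baseRate s p m) with hC₁
  set C₂ := manyLargeSet p (A * s) a with hC₂
  set γ : Measure (Fin n → ℝ) := Measure.pi fun _ => gaussianReal 0 1 with hγ
  let κ : (Fin p → ℝ) → ℝ := fun β => (largeEntries a β ∪ activeSet βs).card * Real.log p
  let G : (Fin n → ℝ) → (Fin p → ℝ) → ENNReal := fun ε β =>
    ENNReal.ofReal (Real.exp (logRatio (Φ * X) (Φ *ᵥ ε) (β - βs)))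
  -- `Q = p^(u/2)`. The weight `W` dominates the mean likelihood ratio on `D₂` and is at least 1, so
  -- it also serves on `D₁`.
  let Q : ℝ := Real.exp (u / 2 * Real.log p)
  let W : (Fin p → ℝ) → ENNReal := fun β =>
    ENNReal.ofReal (Q ^ s) * ENNReal.ofReal (Q ^ (largeEntries a β).card)
  have hp0 : (0 : ℝ) < p := by positivity
  have hL : 0 ≤ Real.log p := Real.log_natCast_nonneg p
  have hLb : Real.log p ≤ b := log_le_sparsity_mul_log hs
  have hQ1 : 1 ≤ Q := Real.one_le_exp (by positivity)
  have hm₁ : MeasurableSet C₁ := measurableSet_farSet _ _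
  have hm₂ : MeasurableSet C₂ := measurableSet_manyLargeSet _ _ _
  have hκm : Measurable κ :=
    ((measurable_from_nat (f := fun k : ℕ => (k : ℝ))).comp
      (measurable_card_largeEntries_union a (activeSet βs))).mul_const _
  have hvm : Measurable fun β : Fin p → ℝ => l2norm ((Φ * X) *ᵥ (β - βs)) ^ 2 :=
    ((continuous_l2norm.comp (Continuous.matrix_mulVec continuous_const
      (continuous_id.sub continuous_const))).pow 2).measurable
  have hGm : Measurable (Function.uncurry G) := by
    refine (Real.measurable_exp.comp ?_).ennreal_ofReal
    refine ((continuous_logRatio (Φ * X)).comp (?_ : Continuous fun z : (Fin n → ℝ) × (Fin p → ℝ) =>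
      (Φ *ᵥ z.1, z.2 - βs))).measurable
    exact (Continuous.matrix_mulVec continuous_const continuous_fst).prodMk
      (continuous_snd.sub continuous_const)
  -- the part of `C₂` where the likelihood ratio is controlled in expectation only
  let D₂ : Set (Fin p → ℝ) := C₂ ∩ {β | l2norm ((Φ * X) *ᵥ (β - βs)) ^ 2 < 400 * κ β}
  let D₁ : Set (Fin p → ℝ) := C₂ ∩ {β | 400 * κ β ≤ l2norm ((Φ * X) *ᵥ (β - βs)) ^ 2}
  have hD₂m : MeasurableSet D₂ := hm₂.inter (measurableSet_lt hvm (hκm.const_mul _))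
  have hD₁m : MeasurableSet D₁ := hm₂.inter (measurableSet_le (hκm.const_mul _) hvm)
  have hW1 : ∀ β, 1 ≤ W β := fun β => by
    simp only [W]
    rw [← ENNReal.ofReal_one, ← ENNReal.ofReal_mul (by positivity)]
    exact ENNReal.ofReal_le_ofReal (one_le_mul_of_one_le_of_one_le (one_le_pow₀ hQ1)
      (one_le_pow₀ hQ1))
  have hWint : ∫⁻ β in C₂, W β ∂ν ≤
      ENNReal.ofReal (Real.exp 1 * Real.exp (-((13 + K) * b))) := by
    have ht0 : (0 : ℝ) ≤ (p : ℝ) ^ (-(1 + u)) := by positivity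
    have h1 := hh.setLIntegral_pow_card_largeEntries_le p (A * s) hQ1 (threshold_nonneg s p m)
      ht0 ht
    simp only [W]
    rw [lintegral_const_mul' _ _ ENNReal.ofReal_ne_top]
    refine (mul_le_mul_right h1 _).trans ?_
    rw [← ENNReal.ofReal_mul (by positivity)]
    refine ENNReal.ofReal_le_ofReal ?_
    -- The choice of `Q` makes `Q² = p^u` exactly offset the prior tail, so the exponential moment
    -- is at most `e`.
    have h2 : (p : ℝ) * (Q ^ 2 * (p : ℝ) ^ (-(1 + u))) = 1 := by
      rw [Real.rpow_def_of_pos hp0, ← Real.exp_nat_mul, ← Real.exp_add,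
        show ((2 : ℕ) : ℝ) * (u / 2 * Real.log p) + Real.log p * -(1 + u) = -Real.log p by
          push_cast; ring, Real.exp_neg, Real.exp_log hp0, mul_inv_cancel₀ hp0.ne']
    have h3 : Q ^ s / Q ^ (A * s) ≤ Real.exp (-((13 + K) * b)) := by
      rw [← Real.exp_nat_mul, ← Real.exp_nat_mul, ← Real.exp_sub]
      refine Real.exp_le_exp.2 ?_
      have h4 := mul_le_mul_of_nonneg_right hA (hL.trans hLb)
      push_cast
      have h5 : (s : ℝ) * (u / 2 * Real.log p) - A * s * (u / 2 * Real.log p) =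
        -(u / 2 * (A - 1) * b) := by rw [hb]; ring
      rw [h5]
      linarith
    rw [h2]
    calc Q ^ s * (Real.exp 1 / Q ^ (A * s)) = Real.exp 1 * (Q ^ s / Q ^ (A * s)) := by ring
      _ ≤ _ := by gcongr
  have hED : ∫⁻ ε, ∫⁻ β in D₂, G ε β ∂ν ∂γ ≤ ∫⁻ β in C₂, W β ∂ν := by
    -- By Tonelli, the noise is averaged first, at fixed `β`.
    rw [lintegral_lintegral_swap hGm.aemeasurable]
    refine (setLIntegral_mono' (g := W) hD₂m fun β hβ => ?_).trans
      (lintegral_mono_set Set.inter_subset_left)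
    refine (lintegral_exp_logRatio_le hΦ (β - βs)).trans ?_
    simp only [W]
    rw [← ENNReal.ofReal_mul (by positivity), ← pow_add]
    refine ENNReal.ofReal_le_ofReal ?_
    rw [← Real.exp_nat_mul]
    refine Real.exp_le_exp.2 ?_
    have h1 : l2norm ((Φ * X) *ᵥ (β - βs)) ^ 2 < 400 * κ β := hβ.2
    have h2 : κ β ≤ (s + (largeEntries a β).card : ℕ) * Real.log p := by
      simp only [κ]
      gcongr
      rw [add_comm]
      exact Finset.card_union_le _ _
    have h3 : 0 ≤ κ β := by positivity
    calc τ * l2norm ((Φ * X) *ᵥ (β - βs)) ^ 2 / 2 ≤ τ * (400 * κ β) / 2 := by gcongr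
      _ = 200 * τ * κ β := by ring
      _ ≤ u / 2 * ((s + (largeEntries a β).card : ℕ) * Real.log p) := by gcongr
      _ = _ := by ring
  -- on the noise event
  let c : ENNReal := ENNReal.ofReal (Real.exp ((12 + K) * b))
  have hgood : ∀ ε, NoiseBounded (Φ * X) (Φ *ᵥ ε) (Real.log p) →
      ‖posterior (Φ * X) h (Φ *ᵥ (X *ᵥ βs + ε)) (C₁ ∪ C₂)‖ₑ ≤
        c * (ENNReal.ofReal (Real.exp (-((13 + K) * b))) + ∫⁻ β in C₂, W β ∂ν) +
          c * ∫⁻ β in D₂, G ε β ∂ν := by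
    intro ε H
    rw [Matrix.mulVec_add, Matrix.mulVec_mulVec]
    refine (enorm_posterior_le (Φ * X) hh _ βs (hm₁.union hm₂)).trans ?_
    have hden := H.le_lintegral_exp_logRatio (by omega) hm hs hcol hbox
    refine (ENNReal.div_le_div_left hden _).trans ?_
    rw [div_eq_mul_inv, ← ENNReal.ofReal_inv_of_pos (Real.exp_pos _), ← Real.exp_neg, neg_neg,
      mul_comm, ← mul_add]
    refine mul_le_mul_right ?_ _
    have hcover : C₁ ∪ C₂ ⊆ (C₁ \ C₂) ∪ (D₁ ∪ D₂) := by
      intro β hβ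
      by_cases h2 : β ∈ C₂
      · right
        rcases le_or_gt (400 * κ β) (l2norm ((Φ * X) *ᵥ (β - βs)) ^ 2) with h3 | h3
        · exact Or.inl ⟨h2, h3⟩
        · exact Or.inr ⟨h2, h3⟩
      · exact Or.inl ⟨hβ.resolve_right h2, h2⟩
    refine (lintegral_mono_set hcover).trans ((lintegral_union_le _ _ _).trans ?_)
    rw [add_assoc]
    refine add_le_add ?_ ((lintegral_union_le _ _ _).trans (add_le_add ?_ le_rfl))
    · calc ∫⁻ β in C₁ \ C₂, G ε β ∂ν
          ≤ ∫⁻ _β in C₁ \ C₂, ENNReal.ofReal (Real.exp (-((13 + K) * b))) ∂ν := by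
            refine setLIntegral_mono' (hm₁.diff hm₂) fun β hβ =>
              ENNReal.ofReal_le_ofReal (Real.exp_le_exp.2 ?_)
            exact H.logRatio_le_of_mem_farSet hp hm hs hcol hRE hE hD0 hD₁ hD₂ hβ.1 hβ.2
        _ ≤ ENNReal.ofReal (Real.exp (-((13 + K) * b))) := by
            rw [setLIntegral_const]
            exact mul_le_of_le_one_right' prob_le_one
    · refine (setLIntegral_mono' (g := W) hD₁m fun β hβ => ?_).trans
        (lintegral_mono_set Set.inter_subset_left)
      refine le_trans ?_ (hW1 β)
      rw [← ENNReal.ofReal_one, ← Real.exp_zero]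
      refine ENNReal.ofReal_le_ofReal (Real.exp_le_exp.2 ?_)
      refine (H.logRatio_le_of_large hp hm hs hcol hβ.2).trans ?_
      rw [neg_nonpos]
      positivity
  set N : Set (Fin n → ℝ) := {ε | ¬ NoiseBounded (Φ * X) (Φ *ᵥ ε) (Real.log p)} with hN
  have hNprob : γ N ≤ ENNReal.ofReal (Real.exp (1 / p) - 1) := by
    refine pi_gaussianReal_not_noiseBounded (Φ * X) (fun v => (hΦ v).trans ?_) hp
    gcongr
    linarith
  -- On the bad noise event the posterior is only bounded by 1. A measurable hull of `N` is used, so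
  -- measurability of `N` itself is not needed.
  have hpoint : ∀ ε, ‖posterior (Φ * X) h (Φ *ᵥ (X *ᵥ βs + ε)) (C₁ ∪ C₂)‖ₑ ≤
      (toMeasurable γ N).indicator 1 ε +
        (c * (ENNReal.ofReal (Real.exp (-((13 + K) * b))) + ∫⁻ β in C₂, W β ∂ν) +
          c * ∫⁻ β in D₂, G ε β ∂ν) := by
    intro ε
    by_cases hε : ε ∈ N
    · rw [Set.indicator_of_mem (subset_toMeasurable γ N hε)]
      refine le_trans ?_ le_self_add
      rw [Matrix.mulVec_add, Matrix.mulVec_mulVec]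
      exact enorm_posterior_le_one (Φ * X) hh _ βs (hm₁.union hm₂)
    · exact (hgood ε (not_not.1 hε)).trans le_add_self
  have hcW : c * ∫⁻ β in C₂, W β ∂ν ≤ ENNReal.ofReal (Real.exp 1 * Real.exp (-b)) := by
    refine (mul_le_mul_right hWint _).trans ?_
    rw [← ENNReal.ofReal_mul (by positivity)]
    refine ENNReal.ofReal_le_ofReal (le_of_eq ?_)
    rw [mul_left_comm, ← Real.exp_add]
    congr 2
    ring
  have hcF : c * ENNReal.ofReal (Real.exp (-((13 + K) * b))) = ENNReal.ofReal (Real.exp (-b)) := by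
    rw [← ENNReal.ofReal_mul (by positivity), ← Real.exp_add]
    congr 2
    ring
  refine (enorm_integral_le_lintegral_enorm _).trans ((lintegral_mono hpoint).trans ?_)
  rw [lintegral_add_left (measurable_one.indicator (measurableSet_toMeasurable _ _)),
    lintegral_indicator_one (measurableSet_toMeasurable _ _), measure_toMeasurable,
    lintegral_add_left measurable_const, lintegral_const, measure_univ, mul_one,
    lintegral_const_mul' c _ ENNReal.ofReal_ne_top, mul_add, hcF]
  have hebp : Real.exp (-b) ≤ 1 / p := by
    rw [one_div, ← Real.exp_log hp0, ← Real.exp_neg]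
    exact Real.exp_le_exp.2 (by linarith)
  have he : (0 : ℝ) ≤ Real.exp (1 / p) - 1 := by
    have := Real.one_le_exp (show (0 : ℝ) ≤ 1 / p by positivity)
    linarith
  calc γ N + (ENNReal.ofReal (Real.exp (-b)) + c * ∫⁻ β in C₂, W β ∂ν +
        c * ∫⁻ ε, ∫⁻ β in D₂, G ε β ∂ν ∂γ)
      ≤ ENNReal.ofReal (Real.exp (1 / p) - 1) + (ENNReal.ofReal (Real.exp (-b)) +
        ENNReal.ofReal (Real.exp 1 * Real.exp (-b)) +
          ENNReal.ofReal (Real.exp 1 * Real.exp (-b))) := by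
        gcongr
        exact (mul_le_mul_right hED _).trans hcW
    _ = ENNReal.ofReal (Real.exp (1 / p) - 1 + (Real.exp (-b) + Real.exp 1 * Real.exp (-b) +
          Real.exp 1 * Real.exp (-b))) := by
        rw [ENNReal.ofReal_add he (by positivity), ENNReal.ofReal_add (by positivity)
          (by positivity), ENNReal.ofReal_add (by positivity) (by positivity)]
    _ ≤ _ := by
        refine ENNReal.ofReal_le_ofReal ?_
        -- With `e ≤ 3` and `exp (-b) ≤ 1/p`, the three terms give `1 + 3 + 3 = 7` times `1/p`.
        have h1 := Real.exp_one_lt_d9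
        have h2 := Real.exp_pos (-b)
        have h3 : Real.exp 1 * Real.exp (-b) ≤ 3 * Real.exp (-b) := by gcongr; linarith
        have h4 : (7 : ℝ) / p = 7 * (1 / p) := by ring
        rw [h4]
        linarith

end finiteSample

/-! ### Asymptotics -/

/-- Since `1 ≤ s log p`, `baseRate` is at least `1/√m ≥ 1/m`; the growth condition on `log m` then
makes `threshold` at least a fixed negative power of `p`. -/
lemma exp_le_threshold {s p m : ℕ} {k : ℝ} (hp : 0 < p) (hm : 0 < m)
    (hb : 1 ≤ s * Real.log p) (hk : Real.log m ≤ k * Real.log p) :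
    Real.exp (-((k + 1) * Real.log p)) ≤ threshold s p m := by
  have hp0 : (0 : ℝ) < p := by exact_mod_cast hp
  have hm0 : (0 : ℝ) < m := by exact_mod_cast hm
  have hm1 : (1 : ℝ) ≤ m := by exact_mod_cast hm
  have h1 : (m : ℝ)⁻¹ ≤ baseRate s p m := by
    refine Real.le_sqrt_of_sq_le ?_
    rw [inv_pow, inv_eq_one_div]
    gcongr
    nlinarith
  calc Real.exp (-((k + 1) * Real.log p)) ≤ Real.exp (-Real.log m + -Real.log p) :=
        Real.exp_le_exp.2 (by linarith)
    _ = (m : ℝ)⁻¹ * (p : ℝ)⁻¹ := by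
        rw [Real.exp_add, Real.exp_neg, Real.exp_neg, Real.exp_log hm0, Real.exp_log hp0]
    _ ≤ baseRate s p m * (p : ℝ)⁻¹ := by gcongr
    _ = _ := by rw [threshold, div_eq_mul_inv]

/-- In `k + k' + 2`, the width of the box costs `k + 1`, the lower bound of the density `k'`, and
the inactive coordinates the final 1. -/
lemma IsProbDensity.exp_le_productPrior_box {h : ℝ → ℝ} (hh : IsProbDensity h) {p m : ℕ}
    {βs : Fin p → ℝ} {M u k k' : ℝ} (hp : 0 < p) (hm : 0 < m)
    (hb : 1 ≤ sparsity βs * Real.log p) (hk : Real.log m ≤ k * Real.log p)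
    (hβs : ∀ j ∈ activeSet βs, |βs j| + threshold (sparsity βs) p m ≤ M)
    (hpu : (p : ℝ) ^ (-u) ≤ 1 / 2)
    (ht : 1 - ∫ x in (-(threshold (sparsity βs) p m))..(threshold (sparsity βs) p m), h x ≤
      (p : ℝ) ^ (-(1 + u)))
    (hg0 : 0 < sInf (h '' Set.Icc (-M) M))
    (hg : -Real.log (sInf (h '' Set.Icc (-M) M)) ≤ k' * Real.log p) :
    ENNReal.ofReal (Real.exp (-((k + k' + 2) * (sparsity βs * Real.log p)))) ≤
      productPrior p h {β | ∀ j, |β j - βs j| ≤ threshold (sparsity βs) p m} := by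
  set s := sparsity βs
  set a := threshold s p m
  set g := sInf (h '' Set.Icc (-M) M)
  have hp0 : (0 : ℝ) < p := by exact_mod_cast hp
  have hp1 : (1 : ℝ) ≤ p := by exact_mod_cast hp
  have hgle : ∀ x, |x| ≤ M → g ≤ h x := fun x hx =>
    csInf_le ⟨0, by rintro _ ⟨y, -, rfl⟩; exact hh.nonneg y⟩ ⟨x, abs_le.1 hx, rfl⟩
  have hpt : (p : ℝ) * (p : ℝ) ^ (-(1 + u)) = (p : ℝ) ^ (-u) := by
    rw [neg_add, Real.rpow_add hp0, Real.rpow_neg_one, ← mul_assoc, mul_inv_cancel₀ hp0.ne',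
      one_mul]
  have ht0 : (0 : ℝ) ≤ (p : ℝ) ^ (-(1 + u)) := by positivity
  have ht1 : (p : ℝ) ^ (-(1 + u)) ≤ 1 := by nlinarith
  refine le_trans (ENNReal.ofReal_le_ofReal ?_)
    (hh.productPrior_box_ge (threshold_nonneg s p m) hg0.le hgle hβs ht ht0 ht1)
  rw [hpt]
  have h1 : Real.exp (-((k + k' + 1) * Real.log p)) ≤ 2 * a * g := by
    have h2 : Real.exp (-((k + 1) * Real.log p)) ≤ a := exp_le_threshold hp hm hb hk
    have h3 : Real.exp (-(k' * Real.log p)) ≤ g := by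
      rw [← Real.exp_log hg0]
      exact Real.exp_le_exp.2 (by linarith)
    have ha0 : 0 ≤ a := threshold_nonneg s p m
    calc Real.exp (-((k + k' + 1) * Real.log p))
        = Real.exp (-((k + 1) * Real.log p)) * Real.exp (-(k' * Real.log p)) := by
          rw [← Real.exp_add]; congr 1; ring
      _ ≤ a * g := by gcongr
      _ ≤ _ := by nlinarith [mul_nonneg ha0 hg0.le]
  have h4 : Real.exp (-(s * Real.log p)) ≤ 1 - (p : ℝ) ^ (-u) := by
    have h5 : Real.exp (-(s * Real.log p)) ≤ Real.exp (-1) := Real.exp_le_exp.2 (by linarith)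
    have h6 : Real.exp (-1) ≤ 1 / 2 := by
      rw [Real.exp_neg, one_div]
      refine inv_anti₀ (by norm_num) ?_
      linarith [Real.add_one_le_exp (1 : ℝ)]
    linarith
  calc Real.exp (-((k + k' + 2) * (s * Real.log p)))
      = Real.exp (-((k + k' + 1) * Real.log p)) ^ s * Real.exp (-(s * Real.log p)) := by
        rw [← Real.exp_nat_mul, ← Real.exp_add]; congr 1; ring
    _ ≤ (2 * a * g) ^ s * (1 - (p : ℝ) ^ (-u)) := by
        have := (Real.exp_pos _).le.trans h1
        gcongr

lemma continuous_matrixNorm₂ {m : ℕ} :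
    Continuous (matrixNorm₂ : Matrix (Fin m) (Fin m) ℝ → ℝ) := by
  unfold matrixNorm₂
  have h : Continuous fun A : Matrix (Fin m) (Fin m) ℝ =>
      Matrix.toEuclideanCLM (𝕜 := ℝ) A :=
    LinearMap.continuous_of_finiteDimensional
      (Matrix.toEuclideanCLM (n := Fin m) (𝕜 := ℝ)).toAlgEquiv.toLinearMap
  exact continuous_norm.comp h

lemma IsGaussianSketch.nullMeasurableSet_matrixNorm₂_le {Ω : Type*} [MeasurableSpace Ω]
    {P : Measure Ω} {m n : ℕ} {Φ : Ω → Matrix (Fin m) (Fin n) ℝ} (hΦ : IsGaussianSketch Φ P)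
    (τ : ℝ) : NullMeasurableSet {ω | matrixNorm₂ (Φ ω * (Φ ω)ᵀ - 1) ≤ τ} P := by
  have h1 : AEMeasurable (fun ω (k : Fin m × Fin n) => Φ ω k.1 k.2) P :=
    aemeasurable_pi_lambda _ fun k => hΦ.aemeasurable k.1 k.2
  have h2 : Continuous fun y : Fin m × Fin n → ℝ =>
      matrixNorm₂ ((Matrix.of fun i j => y (i, j)) * (Matrix.of fun i j => y (i, j))ᵀ - 1) := by
    have h3 : Continuous fun y : Fin m × Fin n → ℝ =>
        (Matrix.of fun i j => y (i, j) : Matrix (Fin m) (Fin n) ℝ) :=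
      continuous_matrix fun i j => continuous_apply (i, j)
    exact continuous_matrixNorm₂.comp
      ((h3.matrix_mul h3.matrix_transpose).sub continuous_const)
  exact (h2.measurable.comp_aemeasurable h1).nullMeasurable (measurableSet_Iic (a := τ))

lemma sparsity_le {p : ℕ} (β : Fin p → ℝ) : sparsity β ≤ p :=
  (Finset.card_le_univ _).trans (by simp)

/-- The grid has at most `p^(3 q)` points, and `hm` makes `3 q log p ≤ m/8`, half of the exponent.
-/
lemma card_sparseGrid_mul_exp_le {p N q c s A m : ℕ} (hp : 0 < p) (hN : N = c * q)
    (hq : q = (A + 1) * s) (hs : s ≤ p) (hpc : 2 * c * (A + 1) + 1 ≤ p)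
    (hm : 24 * (A + 1) * (s * Real.log p) ≤ m) :
    ((sparseGrid p N q).card : ℝ) * Real.exp (-(m / 4 : ℝ)) ≤ Real.exp (-(m / 8 : ℝ)) := by
  have hp0 : (0 : ℝ) < p := by exact_mod_cast hp
  have h1 : p * (2 * N + 1) ≤ p ^ 3 := by
    have h2 : 2 * N + 1 ≤ (2 * c * (A + 1) + 1) * p := by
      subst hN hq
      calc 2 * (c * ((A + 1) * s)) + 1 ≤ 2 * (c * ((A + 1) * p)) + 1 * p := by gcongr; omega
        _ = _ := by ring
    calc p * (2 * N + 1) ≤ p * ((2 * c * (A + 1) + 1) * p) := by gcongr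
      _ ≤ p * (p * p) := by gcongr
      _ = p ^ 3 := by ring
  have h3 : ((sparseGrid p N q).card : ℝ) ≤ ((p : ℝ) ^ 3) ^ q := by
    exact_mod_cast (card_sparseGrid_le p N q).trans (Nat.pow_le_pow_left h1 q)
  have h4 : ((p : ℝ) ^ 3) ^ q = Real.exp (3 * (A + 1) * (s * Real.log p)) := by
    conv_lhs => rw [← Real.exp_log hp0]
    rw [← Real.exp_nat_mul, ← Real.exp_nat_mul, hq]
    congr 1
    push_cast
    ring
  calc ((sparseGrid p N q).card : ℝ) * Real.exp (-(m / 4 : ℝ))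
      ≤ Real.exp (3 * (A + 1) * (s * Real.log p)) * Real.exp (-(m / 4 : ℝ)) := by
        rw [← h4]; gcongr
    _ ≤ _ := by
        rw [← Real.exp_add]
        exact Real.exp_le_exp.2 (by linarith)

end SketchedRegression

theorem theorem1 {Ω : Type*} [MeasurableSpace Ω] (P : Measure Ω) [IsProbabilityMeasure P]
    (m p : ℕ → ℕ)
    (Φ : ∀ n, Ω → Matrix (Fin (m n)) (Fin n) ℝ)
    (X : ∀ n, Matrix (Fin n) (Fin (p n)) ℝ)
    (βs : ∀ n, Fin (p n) → ℝ)
    (h : ℕ → ℝ → ℝ) (M : ℕ → ℝ) (sbar : ℕ → ℕ) (C' η u : ℝ)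
    -- the asymptotic regime
    (hm : Tendsto m atTop atTop) (hp : Tendsto p atTop atTop)
    (hmp : (fun n => Real.log (m n)) =O[atTop] fun n => Real.log (p n))
    (hs : ∀ᶠ n in atTop, 1 ≤ sparsity (βs n))
    -- the Gaussian sketch and the prior densities
    (hΦ : ∀ n, IsGaussianSketch (Φ n) P)
    (hh : ∀ n, IsProbDensity (h n))
    -- (A)
    (hA : ∀ᶠ n in atTop, ∀ i j, |X n i j| ≤ 1)
    -- (B)
    (hC' : 0 < C')
    (hB : Tendsto
      (fun n => P {ω | matrixNorm₂ (Φ n ω * (Φ n ω).transpose - 1) ≤ C' * √((m n : ℝ) / n)})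
      atTop (𝓝 1))
    -- (C)
    (hC₁ : (fun n => (sparsity (βs n) : ℝ) * Real.log (p n)) =o[atTop] fun n => (m n : ℝ))
    (hC₂ : (fun n => (m n : ℝ)) =o[atTop] fun n => (n : ℝ))
    -- (D)
    (hη : 0 < η)
    (hsbar : (fun n => (sparsity (βs n) : ℝ)) =o[atTop] fun n => (sbar n : ℝ))
    (hD : ∀ᶠ n in atTop, ∀ ξ : Finset (Fin (p n)), activeSet (βs n) ⊆ ξ → ξ.card ≤ sbar n →
      η ≤ minEigenvalue ((n : ℝ)⁻¹ • ((columns (X n) ξ).transpose * columns (X n) ξ)))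
    -- (E)
    (hM : Monotone M)
    (hE : ∀ᶠ n in atTop, ∀ j ∈ activeSet (βs n), |βs n j| < M n / 2)
    -- (F)
    (hu : 0 < u)
    (hF : ∀ᶠ n in atTop,
      1 - ∫ x in (-(threshold (sparsity (βs n)) (p n) (m n)))..
          (threshold (sparsity (βs n)) (p n) (m n)), h n x ≤ (p n : ℝ) ^ (-(1 + u)))
    -- (G)
    (hG₀ : ∀ᶠ n in atTop, 0 < sInf (h n '' Set.Icc (-(M n)) (M n)))
    (hG : (fun n => -Real.log (sInf (h n '' Set.Icc (-(M n)) (M n))))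
      =O[atTop] fun n => Real.log (p n)) :
    ∃ E : ℝ, 0 < E ∧ ∃ stilde : ℕ → ℕ,
      (fun n => (stilde n : ℝ)) =O[atTop] (fun n => (sparsity (βs n) : ℝ)) ∧
      TendstoInMeasure P
        (fun n ω => expectedPosterior (Φ n ω) (X n) (βs n) (h n)
          (farSet (βs n) (E * baseRate (sparsity (βs n)) (p n) (m n)) ∪
            manyLargeSet (p n) (stilde n) (threshold (sparsity (βs n)) (p n) (m n))))
        atTop (fun _ => (0 : ℝ)) := by
  obtain ⟨k, hk0, hk⟩ := hmp.exists_pos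
  obtain ⟨k', hk'0, hk'⟩ := hG.exists_pos
  set K : ℝ := k + k' + 2 with hK
  -- `A` is large enough for the prior penalty on `A s` large entries to beat the loss `13 + K`,
  -- after one factor `Q ^ s` is given up.
  obtain ⟨A, hA'⟩ := exists_nat_ge (1 + 2 * (13 + K) / u)
  have hAK : 13 + K ≤ u / 2 * (A - 1) := by
    have h1 : 2 * (13 + K) / u ≤ A - 1 := by linarith
    rw [div_le_iff₀ hu] at h1
    linarith
  have hsη : 0 < √η := Real.sqrt_pos.2 hη
  -- `D` is the sum of both required lower bounds, and `D ≥ 1` gives `D ≤ D²`; `E` is then solved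
  -- from `E √η / 4 - 2 ≥ D`.
  set D : ℝ := 400 * (A + 1) + 5 * (13 + K) with hDdef
  have hD1 : 1 ≤ D := by
    have : (0 : ℝ) ≤ A := Nat.cast_nonneg A
    linarith
  set E : ℝ := 4 * (D + 2) / √η + 1 with hEdef
  have hE1 : 1 ≤ E := by
    have : 0 ≤ 4 * (D + 2) / √η := by positivity
    linarith
  have hED : D ≤ E * √η / 4 - 2 := by
    have h1 : E * √η / 4 - 2 = D + √η / 4 := by
      rw [hEdef]; field_simp; ring
    linarith
  have hED2 : D ≤ (E * √η / 4 - 2) ^ 2 := by nlinarith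
  -- The grid mesh is `1 / (c q)`; the two bounds on `c` are the two fineness conditions of
  -- `restricted_eigenvalue_of_grid`.
  obtain ⟨c, hc⟩ := exists_nat_ge (16 / √η + 2)
  have hc1 : 16 ≤ √η * c := by
    have h1 : 16 / √η ≤ c := by linarith
    rw [div_le_iff₀ hsη] at h1
    linarith
  have hc2 : (2 : ℝ) ≤ c := by
    have : 0 ≤ 16 / √η := by positivity
    linarith
  refine ⟨E, by linarith, fun n => A * sparsity (βs n), ?_, ?_⟩
  · refine IsBigO.of_bound A (Eventually.of_forall fun n => ?_)
    simp
  set τ : ℕ → ℝ := fun n => C' * √((m n : ℝ) / n) with hτdef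
  -- the exceptional events
  let B₁ : ℕ → Set Ω := fun n => {ω | matrixNorm₂ (Φ n ω * (Φ n ω).transpose - 1) ≤ τ n}
  let B₂ : ℕ → Set Ω := fun n => {ω | ∃ j, 4 * (m n : ℝ) < l2norm ((Φ n ω * X n).col j) ^ 2}
  let q : ℕ → ℕ := fun n => (A + 1) * sparsity (βs n)
  let B₃ : ℕ → Set Ω := fun n => {ω | ∃ x ∈ sparseGrid (p n) (c * q n) (q n),
    l2norm ((Φ n ω * X n).mulVec x) ^ 2 < m n / 4 * (l2norm ((X n).mulVec x) ^ 2 / n)}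
  have hlim₁ : Tendsto (fun n => P (B₁ n)ᶜ) atTop (𝓝 0) := by
    have h1 : ∀ n, P (B₁ n)ᶜ = 1 - P (B₁ n) := fun n =>
      prob_compl_eq_one_sub₀ ((hΦ n).nullMeasurableSet_matrixNorm₂_le (τ n))
    simp_rw [h1]
    have h2 := ENNReal.Tendsto.sub (tendsto_const_nhds (x := (1 : ENNReal))) hB
      (Or.inl ENNReal.one_ne_top)
    rwa [tsub_self] at h2
  have hmR : Tendsto (fun n => (m n : ℝ)) atTop atTop := tendsto_natCast_atTop_atTop.comp hm
  have hpR : Tendsto (fun n => (p n : ℝ)) atTop atTop := tendsto_natCast_atTop_atTop.comp hp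
  have hlimexp : Tendsto (fun n => ENNReal.ofReal (Real.exp (-((m n : ℝ) / 8)))) atTop (𝓝 0) := by
    have h1 : Tendsto (fun n => Real.exp (-((m n : ℝ) / 8))) atTop (𝓝 0) :=
      Real.tendsto_exp_neg_atTop_nhds_zero.comp (hmR.atTop_div_const (by norm_num))
    simpa using ENNReal.tendsto_ofReal h1
  have hlimp : Tendsto (fun n => ENNReal.ofReal (Real.exp (1 / (p n : ℝ)) - 1 + 7 / (p n : ℝ)))
      atTop (𝓝 0) := by
    have h1 : Tendsto (fun n => 1 / (p n : ℝ)) atTop (𝓝 0) := hpR.const_div_atTop 1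
    have h2 : Tendsto (fun n => 7 / (p n : ℝ)) atTop (𝓝 0) := hpR.const_div_atTop 7
    have h3 := ((Real.continuous_exp.tendsto 0).comp h1).sub_const 1 |>.add h2
    have h4 := ENNReal.tendsto_ofReal h3
    simpa using h4
  have evm : ∀ᶠ n in atTop, 0 < m n := hm.eventually_gt_atTop 0
  have evp3 : ∀ᶠ n in atTop, 3 ≤ p n := hp.eventually_ge_atTop 3
  have evn : ∀ᶠ n : ℕ in atTop, 0 < n := eventually_gt_atTop 0
  have evb : ∀ᶠ n in atTop, ∀ r : ℝ, r = (m n : ℝ) → 24 * ((A : ℝ) + 1) *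
      (sparsity (βs n) * Real.log (p n)) ≤ r := by
    filter_upwards [hC₁.def (show (0 : ℝ) < 1 / (24 * ((A : ℝ) + 1)) by positivity)] with n h1 r hr
    rw [Real.norm_of_nonneg (mul_nonneg (Nat.cast_nonneg _) (Real.log_natCast_nonneg _)),
      Real.norm_of_nonneg (Nat.cast_nonneg _), one_div, inv_mul_eq_div,
      le_div_iff₀ (by positivity)] at h1
    linarith
  have hlim₂ : ∀ᶠ n in atTop, P (B₂ n) ≤ ENNReal.ofReal (Real.exp (-((m n : ℝ) / 8))) := by
    filter_upwards [hA, evn, evb, evp3, hs] with n hAn hn hb hp3 hsn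
    refine ((hΦ n).measure_exists_col_gt hn hAn).trans (ENNReal.ofReal_le_ofReal ?_)
    have hp0 : (0 : ℝ) < p n := by positivity
    have h1 := log_le_sparsity_mul_log (βs := βs n) hsn
    have h2 : 0 ≤ Real.log (p n) := Real.log_natCast_nonneg _
    have h3 := hb _ rfl
    have h4 : 0 ≤ (A : ℝ) * (sparsity (βs n) * Real.log (p n)) := by positivity
    conv_lhs => rw [← Real.exp_log hp0, ← Real.exp_add]
    exact Real.exp_le_exp.2 (by nlinarith)
  have hlim₃ : ∀ᶠ n in atTop, P (B₃ n) ≤ ENNReal.ofReal (Real.exp (-((m n : ℝ) / 8))) := by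
    filter_upwards [evn, evb, hp.eventually_ge_atTop (2 * c * (A + 1) + 1)] with n hn hb hpc
    refine ((hΦ n).measure_exists_mem_lt hn (X n) _).trans (ENNReal.ofReal_le_ofReal ?_)
    exact card_sparseGrid_mul_exp_le (by omega) rfl rfl (sparsity_le _) hpc (hb _ rfl)
  -- the deterministic bound off the exceptional events
  obtain ⟨n₀, hn₀⟩ := (hs.and hE).exists
  -- A nonzero coefficient at `n₀` makes `M n₀` positive, and monotonicity keeps `M n` above it. The
  -- vanishing `threshold` therefore falls below `M n / 2`, and the boxes around the active
  -- coefficients stay inside `[-M n, M n]`.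
  have hM₀ : 0 < M n₀ := by
    obtain ⟨j, hj⟩ := Finset.card_pos.1 (show 0 < (activeSet (βs n₀)).card from hn₀.1)
    have h1 := hn₀.2 j hj
    have h2 := abs_nonneg (βs n₀ j)
    linarith
  have eva : ∀ᶠ n in atTop, threshold (sparsity (βs n)) (p n) (m n) ≤ M n / 2 := by
    filter_upwards [hC₁.def (show (0 : ℝ) < (M n₀ / 2) ^ 2 by positivity), evm, evp3,
      eventually_ge_atTop n₀] with n h1 hmn hp3 hn
    rw [Real.norm_of_nonneg (mul_nonneg (Nat.cast_nonneg _) (Real.log_natCast_nonneg _)),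
      Real.norm_of_nonneg (Nat.cast_nonneg _)] at h1
    have hm0 : (0 : ℝ) < m n := by exact_mod_cast hmn
    have hp1 : (1 : ℝ) ≤ p n := by exact_mod_cast (show 1 ≤ p n by omega)
    have h2 : baseRate (sparsity (βs n)) (p n) (m n) ≤ M n₀ / 2 := by
      rw [baseRate, Real.sqrt_le_left (by positivity), div_le_iff₀ hm0]
      exact h1
    have h3 := hM hn
    calc threshold (sparsity (βs n)) (p n) (m n) ≤ baseRate (sparsity (βs n)) (p n) (m n) :=
          div_le_self (baseRate_nonneg _ _ _) hp1
      _ ≤ _ := by linarith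
  -- The bound `u / 400` is the condition `200 τ ≤ u / 2`; it comes from `m = o(n)`.
  have evτ : ∀ᶠ n in atTop, τ n ≤ min 1 (u / 400) := by
    have hpos : 0 < min 1 (u / 400) := lt_min one_pos (by positivity)
    filter_upwards [hC₂.def (show (0 : ℝ) < (min 1 (u / 400) / C') ^ 2 by positivity), evn]
      with n h1 hn
    have hn0 : (0 : ℝ) < n := by exact_mod_cast hn
    rw [Real.norm_of_nonneg (Nat.cast_nonneg _), Real.norm_of_nonneg (Nat.cast_nonneg _)] at h1
    have h2 : √((m n : ℝ) / n) ≤ min 1 (u / 400) / C' := by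
      rw [Real.sqrt_le_left (by positivity), div_le_iff₀ hn0]
      exact h1
    rw [le_div_iff₀ hC'] at h2
    simp only [hτdef]
    linarith
  have evsbar : ∀ᶠ n in atTop, (A + 1) * sparsity (βs n) ≤ sbar n := by
    filter_upwards [hsbar.def (show (0 : ℝ) < 1 / ((A : ℝ) + 1) by positivity)] with n h1
    rw [Real.norm_of_nonneg (Nat.cast_nonneg _), Real.norm_of_nonneg (Nat.cast_nonneg _), one_div,
      inv_mul_eq_div, le_div_iff₀ (by positivity)] at h1
    have h2 : (((A + 1) * sparsity (βs n) : ℕ) : ℝ) ≤ sbar n := by push_cast; linarith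
    exact_mod_cast h2
  have evpu : ∀ᶠ n in atTop, (p n : ℝ) ^ (-u) ≤ 1 / 2 :=
    ((tendsto_rpow_neg_atTop hu).comp hpR).eventually_le_const (by norm_num)
  have hmain : ∀ᶠ n in atTop, ∀ ω, ω ∈ B₁ n → ω ∉ B₂ n → ω ∉ B₃ n →
      ‖expectedPosterior (Φ n ω) (X n) (βs n) (h n)
        (farSet (βs n) (E * baseRate (sparsity (βs n)) (p n) (m n)) ∪
          manyLargeSet (p n) (A * sparsity (βs n))
            (threshold (sparsity (βs n)) (p n) (m n)))‖ₑ ≤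
      ENNReal.ofReal (Real.exp (1 / (p n : ℝ)) - 1 + 7 / (p n : ℝ)) := by
    filter_upwards [hs, hD, hE, hF, hG₀, evm, evp3, evn, eva, evτ, evsbar, evpu, hk.bound,
      hk'.bound] with n hsn hDn hEn hFn hG₀n hmn hp3 hn han hτn hsbarn hpun hkn hk'n ω h1 h2 h3
    have hL : 0 ≤ Real.log (p n) := Real.log_natCast_nonneg _
    rw [Real.norm_of_nonneg hL] at hkn hk'n
    have hcol : ∀ j, l2norm ((Φ n ω * X n).col j) ≤ 2 * √(m n) := by
      intro j
      refine abs_le_of_sq_le_sq' ?_ (by positivity) |>.2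
      rw [mul_pow, Real.sq_sqrt (by positivity)]
      by_contra! hcon
      exact h2 ⟨j, by linarith⟩
    have hb1 : 1 ≤ sparsity (βs n) * Real.log (p n) := by
      refine le_trans ?_ (log_le_sparsity_mul_log hsn)
      rw [Real.le_log_iff_exp_le (by positivity)]
      have : (3 : ℝ) ≤ p n := by exact_mod_cast hp3
      linarith [Real.exp_one_lt_d9]
    have hτ1 := hτn.trans (min_le_left _ _)
    have hτ2 := hτn.trans (min_le_right _ _)
    have hqpos : (1 : ℝ) ≤ q n := by
      have : 1 ≤ q n := Nat.one_le_iff_ne_zero.2 (Nat.mul_ne_zero (by omega) (by omega))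
      exact_mod_cast this
    refine enorm_expectedPosterior_le (K := K) (τ := τ n) (η := η) (hh n) (by omega) hmn hsn
      (l2norm_transpose_mulVec_sq_le h1) (by positivity) hτ1 hu (by linarith) hcol ?_ hFn ?_ hE1
      (by linarith) ?_ ?_ hAK
    · intro S hS hScard x hx
      refine restricted_eigenvalue_of_grid (X := X n) (N := c * q n) (q := q n) hη (by omega) hn
        ?_ ?_ ?_ hcol ?_ hScard ?_ hx
      · have : (0 : ℝ) < (c * q n : ℕ) := by push_cast; positivity
        exact_mod_cast this
      · push_cast; gcongr
      · push_cast; rw [← mul_assoc]; gcongr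
      · intro y hy
        by_contra! hcon
        exact h3 ⟨y, hy, hcon⟩
      · intro y hy
        exact l2norm_mulVec_sq_ge_of_le_minEigenvalue hn (X n)
          (hDn S hS (hScard.trans hsbarn)) hy
    · refine (hh n).exp_le_productPrior_box (M := M n) (by omega) hmn hb1
        ((le_abs_self _).trans hkn) ?_ hpun hFn hG₀n ((le_abs_self _).trans hk'n)
      intro j hj
      linarith [hEn j hj]
    · linarith
    · linarith [show (0 : ℝ) ≤ A from Nat.cast_nonneg A]
  intro ε hε
  have hsum : Tendsto (fun n => P (B₁ n)ᶜ + (ENNReal.ofReal (Real.exp (-((m n : ℝ) / 8))) +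
      ENNReal.ofReal (Real.exp (-((m n : ℝ) / 8))))) atTop (𝓝 0) := by
    simpa using hlim₁.add (hlimexp.add hlimexp)
  refine tendsto_of_tendsto_of_tendsto_of_le_of_le' tendsto_const_nhds hsum
    (Eventually.of_forall fun _ => zero_le) ?_
  filter_upwards [hmain, hlim₂, hlim₃, hlimp.eventually_lt_const hε] with n h1 h2 h3 h4
  -- Once the deterministic bound is below `ε`, a deviation of size `ε` can only occur on the
  -- exceptional events.
  have hsub : {ω | ε ≤ edist (expectedPosterior (Φ n ω) (X n) (βs n) (h n)
      (farSet (βs n) (E * baseRate (sparsity (βs n)) (p n) (m n)) ∪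
        manyLargeSet (p n) (A * sparsity (βs n))
          (threshold (sparsity (βs n)) (p n) (m n)))) 0} ⊆ (B₁ n)ᶜ ∪ (B₂ n ∪ B₃ n) := by
    intro ω hω
    by_contra hcon
    simp only [Set.mem_union, Set.mem_compl_iff, not_or, not_not] at hcon
    have h5 := h1 ω hcon.1 hcon.2.1 hcon.2.2
    rw [← edist_zero_right] at h5
    exact absurd (le_trans hω h5) (not_le.2 h4)
  refine (measure_mono hsub).trans ((measure_union_le _ _).trans ?_)
  gcongr
  exact (measure_union_le _ _).trans (add_le_add h2 h3)
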